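/- **Theorem A.1 (regret bound with a general Bregman divergence).** Let $\Pi$ be a finite non-empty decision space, $\mathcal M$ a non-empty compact metric space of models, $\mathcal O$ a measurable observation space. Each $M\in\mathcal M$ has an observation law $M(\pi)$ on $\mathcal O$ for every $\pi\in\Pi$ (a Markov kernel in $(M,\pi)$) and a mean reward function $f_M:\Pi\to\mathbb R$; $f$ is bounded and measurable in $M$. Let $\Delta(\cdot)$ denote the Borel probability measures and let $\mathrm{int}(\Delta(\Pi))$ be the set of distributions on $\Pi$ with all weights positive. *Potential.* Let $\Psi:\Delta(\Pi)\to\mathbb R\cup\{\infty\}$ be Legendre with bounded diameter: $\mathrm{diam}(\Psi)=\sup_{u,v\in\Delta(\Pi)}(\Psi(u)-\Psi(v))<\infty$ (so $\Psi$ is finite), $\Psi$ is convex on $\Delta(\Pi)$, differentiable and strictly convex on $\mathrm{int}(\Delta(\Pi))$, and $\|\nabla\Psi(u_n)\|_2\to\infty$ whenever $u_n\in\mathrm{int}(\Delta(\Pi))$ converges to a point of $\Delta(\Pi)\setminus\mathrm{int}(\Delta(\Pi))$; differentiability and $\nabla\Psi$ are understood within the affine hull of the simplex. Put $D_\Psi(u,v)=\Psi(u)-\Psi(v)-\langle\nabla\Psi(v),u-v\rangle$.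 *AIR.* For a belief $\nu\in\Delta(\mathcal M\times\Pi)$ about $(M,\pi^*)$, let $\nu_{\pi^*}$ be the marginal of $\pi^*$ and $\nu_{\pi^*|\pi,o}$ the Bayesian posterior marginal of $\pi^*$ given decision $\pi$ and observation $o\sim M(\pi)$. For $\eta>0$, $q\in\mathrm{int}(\Delta(\Pi))$ and $p\in\Delta(\Pi)$ let $$\mathrm{AIR}^\Psi_{q,\eta}(p,\nu)=\mathbb E\Big[f_M(\pi^*)-f_M(\pi)-\tfrac1\eta D_\Psi(\nu_{\pi^*|\pi,o},\nu_{\pi^*})-\tfrac1\eta D_\Psi(\nu_{\pi^*},q)\Big],$$ where $\pi\sim p$ and $(M,\pi^*)\sim\nu$ are independent and $o\sim M(\pi)$. The symbol $\big\langle\frac{\partial \mathrm{AIR}^\Psi_{q,\eta}(p,\nu)}{\partial\nu}\big|_{\nu=\nu_t},\nu^*-\nu_t\big\rangle\in[-\infty,+\infty]$ denotes the one-sided derivative (lower limit of the difference quotients) of $\varepsilon\mapsto\mathrm{AIR}^\Psi_{q,\eta}(p,(1-\varepsilon)\nu_t+\varepsilon\nu^*)$ at $\varepsilon=0^+$. *Game.*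 In rounds $t=1,\dots,T$ the algorithm chooses $p_t\in\Delta(\Pi)$ and the environment chooses $M_t\in\mathcal M$, both as measurable functions of the past decisions and observations; then $\pi_t\sim p_t$ and $o_t\sim M_t(\pi_t)$. The regret is $\mathrm{Reg}_T=\sup_{\bar\pi\in\Pi}\mathbb E\big[\sum_{t=1}^T f_{M_t}(\bar\pi)-\sum_{t=1}^T f_{M_t}(\pi_t)\big]$. *Beliefs.* Let $\nu_1,\dots,\nu_T\in\Delta(\mathcal M\times\Pi)$ be arbitrary beliefs, $\nu_t$ a measurable function of the history before round $t$, such that, for every round, every history and every $\pi$ with $p_t(\pi)>0$, the law $M_t(\pi)$ is absolutely continuous with respect to the predictive law $\int M(\pi)\,d\nu_t(M,\pi^*)$ (so that the posterior is determined at the actual observation) and $(\nu_t)_{\pi^*|\pi,o}\in\mathrm{int}(\Delta(\Pi))$ for almost every $o$ under the predictive law. Let $q_1\in\mathrm{int}(\Delta(\Pi))$ be a minimizer of $\Psi$ over $\Delta(\Pi)$, and let $q_{t+1}=(\nu_t)_{\pi^*|\pi_t,o_t}$ (an $\mathrm{int}(\Delta(\Pi))$-valued version, measurable in the history). Then for every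 $\eta>0$ and every $T$, $$\mathrm{Reg}_T\le\frac{\mathrm{diam}(\Psi)}{\eta}+\mathbb E\left[\sum_{t=1}^T\left(\mathrm{AIR}^\Psi_{q_t,\eta}(p_t,\nu_t)+\sup_{\nu^*\in\Delta(\mathcal M\times\Pi)}\left\langle\left.\frac{\partial\mathrm{AIR}^\Psi_{q_t,\eta}(p_t,\nu)}{\partial\nu}\right|_{\nu=\nu_t},\nu^*-\nu_t\right\rangle\right)\right],$$ where the right-hand side may be $+\infty$. -/

import Mathlib

open MeasureTheory ProbabilityTheory Filter Topology
open scoped ENNReal NNReal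

noncomputable section

namespace BregmanAIR

section Potential

variable {A : Type*} [Fintype A] [DecidableEq A]

/-- The (relative) interior of the probability simplex `Δ(A)`: all weights are positive. -/
def simplexInterior (A : Type*) [Fintype A] : Set (A → ℝ) :=
  {u | u ∈ stdSimplex ℝ A ∧ ∀ a, 0 < u a}

/-- The gradient at `u` of a potential on the simplex. The simplex spans the affine space
`∑ a, u a = 1`, whose directions are the vectors of sum zero, and the gradient is taken in that
space: its coordinate `a` is the derivative of `Ψ` at `u` along the orthogonal projection
`e_a - (1/|A|) ∑ b, e_b` of the basis vector `e_a`. Only the values of `Ψ` on the simplex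
enter. -/
def simplexGrad (Ψ : (A → ℝ) → ℝ) (u : A → ℝ) : A → ℝ := fun a =>
  lineDerivWithin ℝ Ψ (stdSimplex ℝ A) u
    (Pi.single a (1 : ℝ) - fun _ => 1 / (Fintype.card A : ℝ))

/-- Legendre potentials on the simplex, all notions being relative to the affine space spanned
by the simplex. The potential is real-valued on the whole simplex (a potential with values in
`ℝ ∪ {∞}` which is proper and has bounded diameter is finite everywhere), so the interior of its
domain is `simplexInterior A`. -/
structure IsLegendre (Ψ : (A → ℝ) → ℝ) : Prop where
  convexOn : ConvexOn ℝ (stdSimplex ℝ A) Ψ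
  interior_nonempty : (simplexInterior A).Nonempty
  differentiable : ∀ u ∈ simplexInterior A, DifferentiableWithinAt ℝ Ψ (stdSimplex ℝ A) u
  strictConvexOn : StrictConvexOn ℝ (simplexInterior A) Ψ
  grad_tendsto : ∀ (u : ℕ → A → ℝ) (v : A → ℝ), (∀ n, u n ∈ simplexInterior A) →
    v ∈ stdSimplex ℝ A \ simplexInterior A → Tendsto u atTop (𝓝 v) →
    Tendsto (fun n => ‖WithLp.toLp 2 (simplexGrad Ψ (u n))‖) atTop atTop

/-- The set of differences `Ψ u - Ψ v` over the simplex. -/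
def diffSet (Ψ : (A → ℝ) → ℝ) : Set ℝ :=
  {x | ∃ u ∈ stdSimplex ℝ A, ∃ v ∈ stdSimplex ℝ A, x = Ψ u - Ψ v}

/-- `Ψ` has bounded diameter. -/
def BoundedDiam (Ψ : (A → ℝ) → ℝ) : Prop := BddAbove (diffSet Ψ)

/-- `diam(Ψ) = sup_{u, v} (Ψ u - Ψ v)`, over the simplex. -/
def diam (Ψ : (A → ℝ) → ℝ) : ℝ := sSup (diffSet Ψ)

/-- The Bregman divergence `D_Ψ(u, v) = Ψ u - Ψ v - ⟨∇Ψ v, u - v⟩`. -/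
def bregman (Ψ : (A → ℝ) → ℝ) (u v : A → ℝ) : ℝ :=
  Ψ u - Ψ v - ∑ a, simplexGrad Ψ v a * (u a - v a)

end Potential

section AIR

variable {A 𝓜 O : Type*} [Fintype A] [DecidableEq A] [MeasurableSpace A]
  [MeasurableSingletonClass A] [MeasurableSpace 𝓜] [MeasurableSpace O]

/-- The law `M(π)` of the observation when the decision is `π`, as a kernel from the pair
`(M, π*)` (it does not depend on `π*`). Here `K (M, π)` is the law `M(π)`. -/
def obsKernel (K : Kernel (𝓜 × A) O) (π : A) : Kernel (𝓜 × A) O :=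
  K.comap (fun x => (x.1, π)) (by fun_prop)

instance instIsMarkovKernelObsKernel (K : Kernel (𝓜 × A) O) [IsMarkovKernel K] (π : A) :
    IsMarkovKernel (obsKernel K π) := by
  unfold obsKernel; infer_instance

/-- The law of the observation under the belief `ν` when the decision is `π`. -/
def predictive (K : Kernel (𝓜 × A) O) (ν : Measure (𝓜 × A)) (π : A) : Measure O :=
  ν.bind (obsKernel K π)

/-- The marginal `ν_{π*}` of the belief `ν`, as a vector. -/
def marginal (ν : Measure (𝓜 × A)) : A → ℝ := fun a => ν.real {x | x.2 = a}

/-- The marginal posterior `ν_{π*|π,o}`, as a vector: the marginal of the Bayesian posterior of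
the belief `ν` of `(M, π*)` given the decision `π` and the observation `o ∼ M(π)`. -/
def postMarginal [Nonempty A] [Nonempty 𝓜] [StandardBorelSpace 𝓜]
    (K : Kernel (𝓜 × A) O) [IsMarkovKernel K] (ν : Measure (𝓜 × A)) [IsFiniteMeasure ν] (π : A) (o : O) : A → ℝ :=
  marginal (posterior (obsKernel K π) ν o)

/-- The joint law of `((π, (M, π*)), o)` where `π ∼ p` and `(M, π*) ∼ ν` are independent and
`o ∼ M(π)`. -/
def jointLaw (K : Kernel (𝓜 × A) O) (p : Measure A) (ν : Measure (𝓜 × A)) :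
    Measure ((A × (𝓜 × A)) × O) :=
  (p.prod ν) ⊗ₘ (K.comap (fun x : A × (𝓜 × A) => (x.2.1, x.1)) (by fun_prop))

/-- The Algorithmic Information Ratio with potential `Ψ`, reference probability `q` and learning
rate `η`. -/
def air [Nonempty A] [Nonempty 𝓜] [StandardBorelSpace 𝓜]
    (Ψ : (A → ℝ) → ℝ) (η : ℝ) (f : 𝓜 → A → ℝ)
    (K : Kernel (𝓜 × A) O) [IsMarkovKernel K] (q : A → ℝ) (p : Measure A)
    (ν : Measure (𝓜 × A)) [IsFiniteMeasure ν] : ℝ :=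
  ∫ z, (f z.1.2.1 z.1.2.2 - f z.1.2.1 z.1.1
      - 1 / η * bregman Ψ (postMarginal K ν z.1.1 z.2) (marginal ν)
      - 1 / η * bregman Ψ (marginal ν) q) ∂(jointLaw K p ν)

/-- The belief `(1 - ε) ν + ε ν'`, for `0 ≤ ε ≤ 1`. -/
def mix (ν ν' : Measure (𝓜 × A)) (ε : ℝ) : Measure (𝓜 × A) :=
  (1 - ε).toNNReal • ν + ε.toNNReal • ν'

instance instIsFiniteMeasureMix (ν ν' : Measure (𝓜 × A)) [IsFiniteMeasure ν]
    [IsFiniteMeasure ν'] (ε : ℝ) : IsFiniteMeasure (mix ν ν' ε) := by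
  unfold mix; infer_instance

/-- The pairing `⟨∂AIR(p, ν)/∂ν, ν' - ν⟩`: the one-sided derivative at `ν` of the Algorithmic
Information Ratio along `ν' - ν`. It is taken in the extended reals, since it may be `+∞`, and
as a lower limit, which is a limit whenever the derivative exists. -/
def airDeriv [Nonempty A] [Nonempty 𝓜] [StandardBorelSpace 𝓜]
    (Ψ : (A → ℝ) → ℝ) (η : ℝ) (f : 𝓜 → A → ℝ)
    (K : Kernel (𝓜 × A) O) [IsMarkovKernel K] (q : A → ℝ) (p : Measure A)
    (ν ν' : Measure (𝓜 × A)) [IsFiniteMeasure ν] [IsFiniteMeasure ν'] : EReal :=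
  liminf (fun ε : ℝ =>
    (((air Ψ η f K q p (mix ν ν' ε) - air Ψ η f K q p ν) / ε : ℝ) : EReal)) (𝓝[>] 0)

/-- The first-order optimality gap `sup_{ν'} ⟨∂AIR(p, ν)/∂ν, ν' - ν⟩`, the supremum being over
all Borel probability measures `ν'` on `𝓜 × A`. -/
def optGap [Nonempty A] [Nonempty 𝓜] [StandardBorelSpace 𝓜]
    (Ψ : (A → ℝ) → ℝ) (η : ℝ) (f : 𝓜 → A → ℝ)
    (K : Kernel (𝓜 × A) O) [IsMarkovKernel K] (q : A → ℝ) (p : Measure A)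
    (ν : Measure (𝓜 × A)) [IsFiniteMeasure ν] : EReal :=
  ⨆ ν' : ProbabilityMeasure (𝓜 × A), airDeriv Ψ η f K q p ν (ν' : Measure (𝓜 × A))

end AIR

section Game

variable {A 𝓜 O Ω : Type*} [MeasurableSpace A] [MeasurableSpace 𝓜] [MeasurableSpace O]
  [MeasurableSpace Ω]

/-- Histories of `t` rounds: the decisions and observations made so far. -/
abbrev Hist (A O : Type*) (t : ℕ) : Type _ := Fin t → A × O

/-- The history before round `t` (rounds are numbered from `0`). -/
def history (act : ℕ → Ω → A) (obs : ℕ → Ω → O) (t : ℕ) (ω : Ω) : Hist A O t :=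
  fun i => (act i ω, obs i ω)

/-- The law of `(π_t, o_t)` given the history: `π_t ∼ p_t` and `o_t ∼ M_t(π_t)`, where `M_t` is
selected by the environment from the history. -/
def roundKernel (K : Kernel (𝓜 × A) O) {t : ℕ} (p : Kernel (Hist A O t) A)
    (env : Hist A O t → 𝓜) (henv : Measurable env) : Kernel (Hist A O t) (A × O) :=
  p ⊗ₖ (K.comap (fun x : Hist A O t × A => (env x.1, x.2)) (by fun_prop))

/-- The random decisions `act` and observations `obs` are those of the `T`-round game between
the algorithm `p` and the environment `env`. -/
structure IsGame (P : Measure Ω) (T : ℕ) (K : Kernel (𝓜 × A) O)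
    (p : ∀ t, Kernel (Hist A O t) A) (env : ∀ t, Hist A O t → 𝓜)
    (henv : ∀ t, Measurable (env t)) (act : ℕ → Ω → A) (obs : ℕ → Ω → O) : Prop where
  measurable_act : ∀ t, Measurable (act t)
  measurable_obs : ∀ t, Measurable (obs t)
  law : ∀ t < T, P.map (fun ω => (history act obs t ω, (act t ω, obs t ω))) =
    (P.map (history act obs t)) ⊗ₘ (roundKernel K (p t) (env t) (henv t))

/-- The regret `sup_{π*} E[∑_t f_{M_t}(π*) - ∑_t f_{M_t}(π_t)]`. -/
def regret (P : Measure Ω) (T : ℕ) (f : 𝓜 → A → ℝ) (env : ∀ t, Hist A O t → 𝓜)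
    (act : ℕ → Ω → A) (obs : ℕ → Ω → O) : ℝ :=
  ⨆ π : A, ∫ ω, (∑ t ∈ Finset.range T, f (env t (history act obs t ω)) π
    - ∑ t ∈ Finset.range T, f (env t (history act obs t ω)) (act t ω)) ∂P

/-- The expectation `E[Y] = E[Y⁺] - E[Y⁻]` of a random variable with values in the extended
reals. -/
def expectation (P : Measure Ω) (Y : Ω → EReal) : EReal :=
  ((∫⁻ ω, (Y ω).toENNReal ∂P : ℝ≥0∞) : EReal) - ((∫⁻ ω, (-Y ω).toENNReal ∂P : ℝ≥0∞) : EReal)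

end Game

end BregmanAIR

end

set_option linter.unusedSectionVars false

namespace BregmanAIR

/-! ### Convex analysis of the potential on the simplex. -/

section Potential

variable {A : Type*} [Fintype A]

/-! The supremum over `ν*` is bounded below by a single belief: the true model `M_t` together with a
point mass at a competitor `e`. The core of the proof is the one-round inequality that this choice
yields, `AIR + gap ≥ f_M(e) - E f_M(π) - D(δ_e, q_t)/η + E D(δ_e, q_{t+1})/η`, whose divergences
telescope.

The expected divergence of the posterior from the prior is an expected increase of `Ψ`, because the
posterior has mean the prior. Hence the potential of the prior cancels in the ratio (`air_eq`): AIR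
is affine in the belief, minus `1/η` times the expected potential of the posterior. Along the
mixture of `ν` with the point belief, let `r` be the density of `M(π)` with respect to the
predictive law. The predictive density is then `1 - ε + ε r` and the posterior moves along a segment
towards `δ_e` (`postMarginal_mix`). The convexity gap of the potential, divided by `ε`, is
nonnegative and tends pointwise to `r D(δ_e, posterior)` (`perspective_slack`). Fatou's lemma then
bounds the lower derivative from below (`potentialSlack_nonneg_and_le_liminf`,
`le_air_add_airDeriv`). Only this direction is needed, so the divergences may have infinite
expectation.

Since `q_1` minimizes `Ψ`, the first divergence is at most the diameter, and the last one is
nonnegative and can be dropped. Infinite expectations forbid subtracting the divergences after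
integration. Each round is therefore written as a truncated difference in `ℝ≥0∞`, shifted by `2C`
with `C` a bound on the rewards (`round_bound`). A second choice of belief, with `q_t` in place of
`δ_e`, shows that every round is at least `-2C`; this keeps the negative part of the expectation
finite (`le_expectation`). -/

lemma sum_sub_eq_zero {u v : A → ℝ} (hu : u ∈ stdSimplex ℝ A) (hv : v ∈ stdSimplex ℝ A) :
    ∑ a, (v a - u a) = 0 := by
  rw [Finset.sum_sub_distrib, hu.2, hv.2, sub_self]

/-- The segment from `u` to `v` stays in the simplex. -/
lemma add_smul_sub_mem {u v : A → ℝ} (hu : u ∈ stdSimplex ℝ A) (hv : v ∈ stdSimplex ℝ A)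
    {t : ℝ} (h0 : 0 ≤ t) (h1 : t ≤ 1) : u + t • (v - u) ∈ stdSimplex ℝ A :=
  (convex_stdSimplex ℝ A).add_smul_sub_mem hu hv ⟨h0, h1⟩

/-- Moving from an interior point along a direction of sum zero stays in the simplex for a
while. -/
lemma eventually_add_smul_mem {u : A → ℝ} (hu : u ∈ simplexInterior A) {w : A → ℝ}
    (hw : ∑ a, w a = 0) : ∀ᶠ t : ℝ in 𝓝 0, u + t • w ∈ stdSimplex ℝ A := by
  have h : ∀ a, ∀ᶠ t : ℝ in 𝓝 0, 0 < u a + t * w a := fun a => by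
    have hc : Tendsto (fun t : ℝ => u a + t * w a) (𝓝 0) (𝓝 (u a + 0 * w a)) := by
      apply Continuous.tendsto; fun_prop
    refine hc.eventually_const_lt ?_
    simpa using hu.2 a
  filter_upwards [eventually_all.2 h] with t ht
  refine ⟨fun a => by simpa using (ht a).le, ?_⟩
  simp [Finset.sum_add_distrib, ← Finset.mul_sum, hw, hu.1.2]

variable {Ψ : (A → ℝ) → ℝ}

lemma slope_le {u v : A → ℝ} (hu : u ∈ stdSimplex ℝ A) (hv : v ∈ stdSimplex ℝ A)
    (hc : ConvexOn ℝ (stdSimplex ℝ A) Ψ) {t : ℝ} (h0 : 0 < t) (h1 : t ≤ 1) :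
    (Ψ (u + t • (v - u)) - Ψ u) / t ≤ Ψ v - Ψ u := by
  rw [div_le_iff₀ h0]
  have h := hc.2 hu hv (sub_nonneg.2 h1) h0.le (by ring)
  have e : u + t • (v - u) = (1 - t) • u + t • v := by
    rw [smul_sub, sub_smul, one_smul]; abel
  rw [e]
  simp only [smul_eq_mul] at h
  nlinarith

lemma exists_bound (hdiam : BoundedDiam Ψ) : ∃ B, ∀ u ∈ stdSimplex ℝ A, |Ψ u| ≤ B := by
  rcases (stdSimplex ℝ A).eq_empty_or_nonempty with he | ⟨v, hv⟩
  · exact ⟨0, by simp [he]⟩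
  obtain ⟨D, hD⟩ := hdiam
  refine ⟨D + |Ψ v|, fun u hu => ?_⟩
  have h1 : Ψ u - Ψ v ≤ D := hD ⟨u, hu, v, hv, rfl⟩
  have h2 : Ψ v - Ψ u ≤ D := hD ⟨v, hv, u, hu, rfl⟩
  have h3 := abs_le.1 (le_refl |Ψ v|)
  rw [abs_le]; constructor <;> linarith [h3.1, h3.2]

/-- A bounded convex function on the simplex is upper semicontinuous there. -/
lemma upperSemicontinuousOn_stdSimplex (hc : ConvexOn ℝ (stdSimplex ℝ A) Ψ)
    (hdiam : BoundedDiam Ψ) : UpperSemicontinuous fun u : stdSimplex ℝ A => Ψ u.1 := by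
  obtain ⟨B, hB⟩ := exists_bound hdiam
  intro u y hy
  have hy : Ψ u.1 < y := hy
  -- for small `t`, every `v` near `u` is `(1 - t) u + t w` with `w` in the simplex
  obtain ⟨t, ⟨ht0, ht1⟩, hty⟩ : ∃ t ∈ Set.Ioo (0 : ℝ) 1, (1 - t) * Ψ u.1 + t * B < y := by
    have hlim : Tendsto (fun t : ℝ => (1 - t) * Ψ u.1 + t * B) (𝓝[>] 0)
        (𝓝 ((1 - 0) * Ψ u + 0 * B)) := by
      refine (Continuous.tendsto ?_ _).mono_left nhdsWithin_le_nhds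
      fun_prop
    have h1 := hlim.eventually_lt_const (u := y) (by
      rw [sub_zero, one_mul, zero_mul, add_zero]; exact hy)
    obtain ⟨t, h, h'⟩ := (h1.and (Ioo_mem_nhdsGT (zero_lt_one' ℝ))).exists
    exact ⟨t, h', h⟩
  have hev : ∀ a, ∀ᶠ v : stdSimplex ℝ A in 𝓝 u, 0 ≤ v.1 a - (1 - t) * u.1 a := by
    intro a
    -- At a vanishing coordinate of `u` the constraint is just `0 ≤ v a`, so it also holds at
    -- boundary points.
    rcases (u.2.1 a).eq_or_lt with h0 | h0
    · filter_upwards with v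
      have h := v.2.1 a
      rw [← h0]; simpa using h
    · have hcont : Continuous fun v : stdSimplex ℝ A =>
          v.1 a - (1 - t) * u.1 a :=
        ((continuous_apply a).comp continuous_subtype_val).sub continuous_const
      have : 0 < u.1 a - (1 - t) * u.1 a := by nlinarith
      filter_upwards [hcont.tendsto u |>.eventually_const_lt this] with v hv using hv.le
  filter_upwards [eventually_all.2 hev] with v hv
  set w : A → ℝ := fun a => (v.1 a - (1 - t) * u.1 a) / t with hw
  have hwS : w ∈ stdSimplex ℝ A := by
    refine ⟨fun a => div_nonneg (hv a) ht0.le, ?_⟩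
    simp only [hw]
    rw [← Finset.sum_div, Finset.sum_sub_distrib, ← Finset.mul_sum, v.2.2, u.2.2]
    field_simp; ring
  have hvw : v.1 = (1 - t) • u.1 + t • w := by
    ext a; simp [hw]; field_simp; ring
  have h := hc.2 u.2 hwS (sub_nonneg.2 ht1.le) ht0.le (by ring)
  rw [← hvw] at h
  have hwB := (abs_le.1 (hB w hwS)).2
  simp only [smul_eq_mul] at h
  show Ψ v.1 < y
  nlinarith

variable [DecidableEq A]

/-- The gradient represents the derivative in the directions of the simplex. -/
lemma exists_hasFDerivWithinAt {u : A → ℝ} (hu : u ∈ simplexInterior A)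
    (hd : DifferentiableWithinAt ℝ Ψ (stdSimplex ℝ A) u) :
    ∃ L : (A → ℝ) →L[ℝ] ℝ, HasFDerivWithinAt Ψ L (stdSimplex ℝ A) u ∧
      ∀ w : A → ℝ, ∑ a, w a = 0 → ∑ a, simplexGrad Ψ u a * w a = L w := by
  obtain ⟨L, hL⟩ := hd
  refine ⟨L, hL, fun w hw => ?_⟩
  have hne : (Fintype.card A : ℝ) ≠ 0 := by
    intro h0
    have : IsEmpty A := by
      rw [← Fintype.card_eq_zero_iff]; exact_mod_cast h0
    have := hu.1.2
    simp at this
  have key : ∀ a, simplexGrad Ψ u a = L (Pi.single a (1 : ℝ) - fun _ => 1 / (Fintype.card A : ℝ)) := by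
    intro a
    set d : A → ℝ := Pi.single a (1 : ℝ) - fun _ => 1 / (Fintype.card A : ℝ) with hd
    have hsum : ∑ b, d b = 0 := by
      simp [hd, hne]
    have h1 : HasLineDerivWithinAt ℝ Ψ (L d) (stdSimplex ℝ A) u d := hL.hasLineDerivWithinAt d
    -- A two-sided neighbourhood makes the derivative along `d` within the simplex unique, so it
    -- must be `L d`.
    have hmem : (fun t : ℝ => u + t • d) ⁻¹' (stdSimplex ℝ A) ∈ 𝓝 (0 : ℝ) :=
      eventually_add_smul_mem hu hsum
    unfold simplexGrad lineDerivWithin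
    rw [HasDerivWithinAt.derivWithin h1]
    exact uniqueDiffWithinAt_of_mem_nhds hmem
  -- The constant part of the projected basis vectors contributes a multiple of `∑ a, w a = 0`.
  simp_rw [key, map_sub, sub_mul]
  rw [Finset.sum_sub_distrib, ← Finset.mul_sum, hw, mul_zero, sub_zero]
  conv_rhs => rw [pi_eq_sum_univ' w, map_sum]
  refine Finset.sum_congr rfl fun a _ => ?_
  rw [map_smul, smul_eq_mul, mul_comm]

/-- The difference quotients of a potential along a segment of the simplex starting in the
interior converge. -/
lemma tendsto_slope_bregman {u v : A → ℝ} (hu : u ∈ simplexInterior A) (hv : v ∈ stdSimplex ℝ A)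
    (hd : DifferentiableWithinAt ℝ Ψ (stdSimplex ℝ A) u) :
    Tendsto (fun t : ℝ => (Ψ (u + t • (v - u)) - Ψ u) / t) (𝓝[>] 0)
      (𝓝 (Ψ v - Ψ u - bregman Ψ v u)) := by
  obtain ⟨L, hL, hg⟩ := exists_hasFDerivWithinAt hu hd
  have hw := hg (v - u) (sum_sub_eq_zero hu.1 hv)
  have hb : Ψ v - Ψ u - bregman Ψ v u = L (v - u) := by
    rw [← hw]; unfold bregman; simp
  rw [hb]
  have h1 : HasDerivWithinAt (fun t : ℝ => Ψ (u + t • (v - u))) (L (v - u))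
    ((fun t : ℝ => u + t • (v - u)) ⁻¹' (stdSimplex ℝ A)) 0 := hL.hasLineDerivWithinAt (v - u)
  have h2 : HasDerivWithinAt (fun t : ℝ => Ψ (u + t • (v - u))) (L (v - u)) (Set.Ioi 0) 0 := by
    refine h1.mono_of_mem_nhdsWithin ?_
    filter_upwards [Ioo_mem_nhdsGT (zero_lt_one' ℝ)] with t ht
    exact add_smul_sub_mem hu.1 hv ht.1.le ht.2.le
  rw [hasDerivWithinAt_iff_tendsto_slope' (by simp)] at h2
  refine h2.congr fun t => ?_
  simp [slope_def_field]

/-- By convexity the difference quotients from `u` towards `v` never exceed `Ψ v - Ψ u`; their limit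
is the gradient term. -/
lemma bregman_nonneg (hΨ : IsLegendre Ψ) {u v : A → ℝ} (hu : u ∈ simplexInterior A)
    (hv : v ∈ stdSimplex ℝ A) : 0 ≤ bregman Ψ v u := by
  have h := tendsto_slope_bregman hu hv (hΨ.differentiable u hu)
  have := le_of_tendsto h (b := Ψ v - Ψ u) (by
    filter_upwards [Ioo_mem_nhdsGT (zero_lt_one' ℝ)] with t ht
    exact slope_le hu.1 hv hΨ.convexOn ht.1 ht.2.le)
  linarith

lemma bregman_self (u : A → ℝ) : bregman Ψ u u = 0 := by simp [bregman]

/-- The divergence to a minimizer of the potential is at most the diameter. -/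
lemma bregman_le_diam (hΨ : IsLegendre Ψ) (hdiam : BoundedDiam Ψ) {u v : A → ℝ}
    (hu : u ∈ simplexInterior A) (hv : v ∈ stdSimplex ℝ A) (hmin : IsMinOn Ψ (stdSimplex ℝ A) u) :
    bregman Ψ v u ≤ diam Ψ := by
  have h := tendsto_slope_bregman hu hv (hΨ.differentiable u hu)
  -- First-order condition at the minimizer: the gradient term `⟨∇Ψ u, v - u⟩` is nonnegative.
  have h0 := ge_of_tendsto h (b := 0) (by
    filter_upwards [Ioo_mem_nhdsGT (zero_lt_one' ℝ)] with t ht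
    exact div_nonneg (sub_nonneg.2 (hmin (add_smul_sub_mem hu.1 hv ht.1.le ht.2.le))) ht.1.le)
  have : Ψ v - Ψ u ≤ diam Ψ := le_csSup hdiam ⟨v, hv, u, hu.1, rfl⟩
  linarith

/-- The potential is Borel measurable on the simplex. -/
lemma measurable_potential_comp (hΨ : IsLegendre Ψ) (hdiam : BoundedDiam Ψ) {X : Type*}
    [MeasurableSpace X] {g : X → A → ℝ} (hg : Measurable g) (hgS : ∀ x, g x ∈ stdSimplex ℝ A) :
    Measurable fun x => Ψ (g x) :=
  (upperSemicontinuousOn_stdSimplex hΨ.convexOn hdiam).measurable.comp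
    (hg.subtype_mk (h := hgS))

/-- The gradient term is a pointwise limit of difference quotients with step `1/(n+1)`, which
involve only `Ψ` along maps into the simplex. Measurability of the gradient itself is not required.
-/
lemma measurable_bregman_comp (hΨ : IsLegendre Ψ) (hdiam : BoundedDiam Ψ) {X : Type*}
    [MeasurableSpace X] {g : X → A → ℝ} (hg : Measurable g) (hgS : ∀ x, g x ∈ simplexInterior A)
    {v : A → ℝ} (hv : v ∈ stdSimplex ℝ A) : Measurable fun x => bregman Ψ v (g x) := by
  have hΨg := measurable_potential_comp hΨ hdiam hg fun x => (hgS x).1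
  have hseq : Tendsto (fun n : ℕ => 1 / ((n : ℝ) + 1)) atTop (𝓝[>] 0) :=
    tendsto_nhdsWithin_iff.2 ⟨tendsto_one_div_add_atTop_nhds_zero_nat,
      Eventually.of_forall fun n => Set.mem_Ioi.2 (by positivity)⟩
  have hm : Measurable fun x => Ψ v - Ψ (g x) - bregman Ψ v (g x) := by
    refine measurable_of_tendsto_metrizable (f := fun (n : ℕ) x =>
      (Ψ (g x + (1 / ((n : ℝ) + 1)) • (v - g x)) - Ψ (g x)) / (1 / ((n : ℝ) + 1))) (fun n => ?_) ?_
    · refine (Measurable.sub ?_ hΨg).div_const _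
      refine measurable_potential_comp hΨ hdiam (by fun_prop) fun x => ?_
      refine add_smul_sub_mem (hgS x).1 hv (by positivity) ?_
      rw [div_le_one (by positivity)]
      linarith [Nat.cast_nonneg (α := ℝ) n]
    · rw [tendsto_pi_nhds]
      exact fun x => (tendsto_slope_bregman (hgS x) hv (hΨ.differentiable _ (hgS x))).comp hseq
  have h := ((measurable_const (a := Ψ v)).sub hΨg).sub hm
  convert h using 2 with x
  simp

/-- The slack of the perspective of a convex potential along a segment is nonnegative and
converges, at the start of the segment, to the Bregman divergence. -/
lemma perspective_slack (hΨ : IsLegendre Ψ) {u w : A → ℝ} (hu : u ∈ simplexInterior A)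
    (hw : w ∈ stdSimplex ℝ A) {r : ℝ} (hr : 0 ≤ r) {x : ℝ → A → ℝ}
    (hx : ∀ ε ∈ Set.Ioo (0 : ℝ) 1, (1 - ε + ε * r) • x ε = (1 - ε) • u + (ε * r) • w) :
    ∃ Q : ℝ → ℝ, (∀ ε ∈ Set.Ioo (0 : ℝ) 1, 0 ≤ Q ε ∧
        Q ε = r * Ψ w - Ψ u - ((1 - ε + ε * r) * Ψ (x ε) - Ψ u) / ε) ∧
      Tendsto Q (𝓝[>] 0) (𝓝 (r * bregman Ψ w u)) := by
  -- The normalized weight of `w`: the point `x ε` is `u + τ ε • (w - u)`.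
  set τ : ℝ → ℝ := fun ε => ε * r / (1 - ε + ε * r) with hτ
  have hs : ∀ ε ∈ Set.Ioo (0 : ℝ) 1, 0 < 1 - ε + ε * r := fun ε hε => by
    have := mul_nonneg hε.1.le hr; linarith [hε.2]
  have hxτ : ∀ ε ∈ Set.Ioo (0 : ℝ) 1, x ε = u + τ ε • (w - u) := fun ε hε => by
    have hs' := hs ε hε
    ext a
    have := congrFun (hx ε hε) a
    simp only [Pi.smul_apply, Pi.add_apply, smul_eq_mul, Pi.sub_apply, hτ] at this ⊢
    field_simp
    linarith
  refine ⟨fun ε => r * Ψ w - Ψ u - ((1 - ε + ε * r) * Ψ (x ε) - Ψ u) / ε,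
    fun ε hε => ⟨?_, rfl⟩, ?_⟩
  · have hs' := hs ε hε
    have h0 := hε.1
    have hτ0 : 0 ≤ τ ε := div_nonneg (mul_nonneg hε.1.le hr) hs'.le
    have hτ1 : τ ε ≤ 1 := by rw [hτ]; simp only; rw [div_le_one hs']; linarith [hε.2]
    have hconv := hΨ.convexOn.2 hu.1 hw (sub_nonneg.2 hτ1) hτ0 (by ring)
    have e : u + τ ε • (w - u) = (1 - τ ε) • u + τ ε • w := by
      rw [smul_sub, sub_smul, one_smul]; abel
    rw [← e, ← hxτ ε hε] at hconv
    simp only [smul_eq_mul] at hconv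
    have h2 := mul_le_mul_of_nonneg_left hconv hs'.le
    have e2 : (1 - ε + ε * r) * ((1 - τ ε) * Ψ u + τ ε * Ψ w) = (1 - ε) * Ψ u + ε * r * Ψ w := by
      simp only [hτ]; field_simp; ring
    rw [e2] at h2
    rw [sub_nonneg, div_le_iff₀ hε.1]
    linarith
  -- For `r = 0` the weight `τ` is identically zero and does not approach `0` from the right; the
  -- slack is then itself zero.
  rcases hr.eq_or_lt with h0 | h0
  · subst h0
    refine tendsto_const_nhds.congr' ?_
    filter_upwards [Ioo_mem_nhdsGT (zero_lt_one' ℝ)] with ε hε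
    rw [hxτ ε hε]
    have := hε.1.ne'
    simp [hτ]
    field_simp
    ring
  · have hτlim : Tendsto τ (𝓝[>] 0) (𝓝[>] 0) := by
      refine tendsto_nhdsWithin_iff.2 ⟨?_, ?_⟩
      · have : ContinuousAt τ 0 := by
          refine ContinuousAt.div (by fun_prop) (by fun_prop) (by simp)
        have h := this.tendsto.mono_left (nhdsWithin_le_nhds (s := Set.Ioi 0))
        simpa [hτ] using h
      · filter_upwards [Ioo_mem_nhdsGT (zero_lt_one' ℝ)] with ε hε
        exact div_pos (mul_pos hε.1 h0) (hs ε hε)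
    -- Since `(1 - ε + ε r) τ = ε r`, the slack is `r` times `Ψ w - Ψ u` minus the difference
    -- quotient at step `τ`.
    have h := ((tendsto_slope_bregman hu hw (hΨ.differentiable u hu)).comp hτlim).const_sub
      (Ψ w - Ψ u) |>.const_mul r
    have e : r * (Ψ w - Ψ u - (Ψ w - Ψ u - bregman Ψ w u)) = r * bregman Ψ w u := by ring
    rw [e] at h
    refine h.congr' ?_
    filter_upwards [Ioo_mem_nhdsGT (zero_lt_one' ℝ)] with ε hε
    have hs' := hs ε hε
    have := hε.1
    simp only [Function.comp]
    rw [← hxτ ε hε]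
    simp only [hτ]
    field_simp
    ring

end Potential

end BregmanAIR

namespace BregmanAIR

/-! ### Bayes' rule, and posteriors of mixtures with a point belief. -/

section Posterior

lemma toNNReal_smul_withDensity_add {X : Type*} [MeasurableSpace X] (μ : Measure X) {c d : ℝ}
    (hc : 0 ≤ c) (hd : 0 ≤ d) {g h : X → ℝ} (hg : Measurable g) (hh : Measurable h)
    (hg0 : ∀ x, 0 ≤ g x) (hh0 : ∀ x, 0 ≤ h x) :
    c.toNNReal • μ.withDensity (fun x => ENNReal.ofReal (g x)) +
      d.toNNReal • μ.withDensity (fun x => ENNReal.ofReal (h x)) =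
      μ.withDensity fun x => ENNReal.ofReal (c * g x + d * h x) := by
  have e : (fun x => ENNReal.ofReal (c * g x + d * h x)) =
      (ENNReal.ofReal c • fun x => ENNReal.ofReal (g x)) +
        ENNReal.ofReal d • fun x => ENNReal.ofReal (h x) := by
    ext x
    simp only [Pi.add_apply, Pi.smul_apply, smul_eq_mul]
    rw [ENNReal.ofReal_add (mul_nonneg hc (hg0 x)) (mul_nonneg hd (hh0 x)),
      ENNReal.ofReal_mul hc, ENNReal.ofReal_mul hd]
  rw [e, withDensity_add_left (by fun_prop), withDensity_smul _ (by fun_prop),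
    withDensity_smul _ (by fun_prop)]
  rfl

variable {A 𝓜 O : Type*} [Fintype A] [MeasurableSpace A]
  [MeasurableSingletonClass A] [MeasurableSpace 𝓜] [MeasurableSpace O]

lemma measurableSet_snd_eq (a : A) : MeasurableSet {x : 𝓜 × A | x.2 = a} :=
  measurable_snd (measurableSet_singleton a)

lemma marginal_nonneg (ν : Measure (𝓜 × A)) (a : A) : 0 ≤ marginal ν a := measureReal_nonneg

lemma marginal_mem_stdSimplex (ν : Measure (𝓜 × A)) [IsProbabilityMeasure ν] :
    marginal ν ∈ stdSimplex ℝ A := by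
  refine ⟨marginal_nonneg ν, ?_⟩
  have h := sum_measureReal_preimage_singleton (μ := ν) (f := Prod.snd) (Finset.univ : Finset A)
    (fun a _ => measurableSet_snd_eq a) (fun a _ => measure_ne_top _ _)
  simpa [marginal, Set.preimage] using h

/-- The joint law of the observation and of the event `π* = a` under the belief `ν`. -/
noncomputable def jointObs (K : Kernel (𝓜 × A) O) (ν : Measure (𝓜 × A)) (π a : A) : Measure O :=
  (ν.restrict {x | x.2 = a}).bind (obsKernel K π)

lemma jointObs_apply (K : Kernel (𝓜 × A) O) (ν : Measure (𝓜 × A)) (π a : A) {s : Set O}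
    (hs : MeasurableSet s) : jointObs K ν π a s =
      ∫⁻ x, {x : 𝓜 × A | x.2 = a}.indicator (fun x => K (x.1, π) s) x ∂ν := by
  rw [jointObs, Measure.bind_apply hs (Kernel.aemeasurable _),
    lintegral_indicator (measurableSet_snd_eq a)]
  rfl

lemma predictive_apply (K : Kernel (𝓜 × A) O) (ν : Measure (𝓜 × A)) (π : A) {s : Set O}
    (hs : MeasurableSet s) : predictive K ν π s = ∫⁻ x, K (x.1, π) s ∂ν := by
  rw [predictive, Measure.bind_apply hs (Kernel.aemeasurable _)]
  rfl

instance (K : Kernel (𝓜 × A) O) [IsMarkovKernel K] (ν : Measure (𝓜 × A))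
    [IsProbabilityMeasure ν] (π : A) : IsProbabilityMeasure (predictive K ν π) := by
  unfold predictive; infer_instance

/-- The belief under which the model is `M` and `π*` has the distribution `w`. -/
noncomputable def pointBelief (M : 𝓜) (w : A → ℝ) : Measure (𝓜 × A) :=
  ∑ a, ENNReal.ofReal (w a) • Measure.dirac (M, a)

lemma lintegral_pointBelief (M : 𝓜) (w : A → ℝ) {g : 𝓜 × A → ℝ≥0∞} (hg : Measurable g) :
    ∫⁻ x, g x ∂(pointBelief M w) = ∑ a, ENNReal.ofReal (w a) * g (M, a) := by
  simp [pointBelief, lintegral_smul_measure, lintegral_dirac' _ hg]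

lemma isProbabilityMeasure_pointBelief (M : 𝓜) {w : A → ℝ} (hw : w ∈ stdSimplex ℝ A) :
    IsProbabilityMeasure (pointBelief M w) := by
  constructor
  have h := lintegral_pointBelief M w (g := fun _ => 1) measurable_const
  simp only [lintegral_one, mul_one] at h
  rw [h, ← ENNReal.ofReal_sum_of_nonneg fun a _ => hw.1 a, hw.2, ENNReal.ofReal_one]

lemma integral_pointBelief (M : 𝓜) {w : A → ℝ} (hw : w ∈ stdSimplex ℝ A) {g : 𝓜 × A → ℝ}
    (hg : Measurable g) : ∫ x, g x ∂(pointBelief M w) = ∑ a, w a * g (M, a) := by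
  have hi : ∀ a, Integrable g (Measure.dirac (M, a)) := fun a => by
    have : g =ᵐ[Measure.dirac (M, a)] fun _ => g (M, a) := ae_eq_dirac' hg
    exact (integrable_const _).congr this.symm
  rw [pointBelief, integral_finsetSum_measure fun a _ => (hi a).smul_measure (by simp)]
  refine Finset.sum_congr rfl fun a _ => ?_
  rw [integral_smul_measure, integral_dirac' _ _ hg.stronglyMeasurable,
    ENNReal.toReal_ofReal (hw.1 a), smul_eq_mul]

lemma marginal_pointBelief (M : 𝓜) {w : A → ℝ} (hw : w ∈ stdSimplex ℝ A) :
    marginal (pointBelief M w) = w := by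
  classical
  ext a
  have h := integral_pointBelief M hw (g := {x : 𝓜 × A | x.2 = a}.indicator 1)
    (measurable_one.indicator (measurableSet_snd_eq a))
  rw [integral_indicator_one (measurableSet_snd_eq a)] at h
  rw [marginal, h]
  simp [Set.indicator_apply]

lemma isProbabilityMeasure_mix (ν ν' : Measure (𝓜 × A)) [IsProbabilityMeasure ν]
    [IsProbabilityMeasure ν'] {ε : ℝ} (h0 : 0 ≤ ε) (h1 : ε ≤ 1) :
    IsProbabilityMeasure (mix ν ν' ε) := by
  constructor
  simp only [mix, Measure.add_apply, Measure.smul_apply, measure_univ]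
  rw [ENNReal.smul_def, ENNReal.smul_def, smul_eq_mul, smul_eq_mul, mul_one, mul_one]
  change ENNReal.ofReal (1 - ε) + ENNReal.ofReal ε = 1
  rw [← ENNReal.ofReal_add (sub_nonneg.2 h1) h0]; simp

lemma integral_mix (ν ν' : Measure (𝓜 × A)) {ε : ℝ} (h0 : 0 ≤ ε) (h1 : ε ≤ 1)
    {g : 𝓜 × A → ℝ} (hg : Integrable g ν) (hg' : Integrable g ν') :
    ∫ x, g x ∂(mix ν ν' ε) = (1 - ε) * ∫ x, g x ∂ν + ε * ∫ x, g x ∂ν' := by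
  rw [mix, integral_add_measure hg.smul_measure_nnreal hg'.smul_measure_nnreal,
    integral_smul_nnreal_measure, integral_smul_nnreal_measure, NNReal.smul_def, NNReal.smul_def,
    Real.coe_toNNReal _ (sub_nonneg.2 h1), Real.coe_toNNReal _ h0, smul_eq_mul, smul_eq_mul]

lemma marginal_mix (ν ν' : Measure (𝓜 × A)) [IsFiniteMeasure ν] [IsFiniteMeasure ν'] {ε : ℝ}
    (h0 : 0 ≤ ε) (h1 : ε ≤ 1) (a : A) :
    marginal (mix ν ν' ε) a = (1 - ε) * marginal ν a + ε * marginal ν' a := by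
  have hi : ∀ μ : Measure (𝓜 × A), IsFiniteMeasure μ →
      Integrable ({x : 𝓜 × A | x.2 = a}.indicator (1 : 𝓜 × A → ℝ)) μ := fun μ _ =>
    (integrable_const (1 : ℝ)).indicator (measurableSet_snd_eq a)
  have h := integral_mix ν ν' h0 h1 (hi ν inferInstance) (hi ν' inferInstance)
  rw [integral_indicator_one (measurableSet_snd_eq a), integral_indicator_one
    (measurableSet_snd_eq a), integral_indicator_one (measurableSet_snd_eq a)] at h
  exact h

lemma jointObs_mix (K : Kernel (𝓜 × A) O) (ν : Measure (𝓜 × A)) (M : 𝓜) (w : A → ℝ) (ε : ℝ)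
    (π a : A) : jointObs K (mix ν (pointBelief M w) ε) π a =
      (1 - ε).toNNReal • jointObs K ν π a + ε.toNNReal • ENNReal.ofReal (w a) • K (M, π) := by
  classical
  ext s hs
  have hm : Measurable ({x : 𝓜 × A | x.2 = a}.indicator fun x => K (x.1, π) s) :=
    ((K.measurable_coe hs).comp (by fun_prop : Measurable fun x : 𝓜 × A => (x.1, π))).indicator
      (measurableSet_snd_eq a)
  rw [jointObs_apply K _ π a hs, mix, lintegral_add_measure, lintegral_smul_measure,
    lintegral_smul_measure, lintegral_pointBelief M w hm, ← jointObs_apply K _ π a hs]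
  simp [Set.indicator_apply]

lemma predictive_mix (K : Kernel (𝓜 × A) O) (ν : Measure (𝓜 × A)) (M : 𝓜) {w : A → ℝ}
    (hw : w ∈ stdSimplex ℝ A) (ε : ℝ) (π : A) : predictive K (mix ν (pointBelief M w) ε) π =
      (1 - ε).toNNReal • predictive K ν π + ε.toNNReal • K (M, π) := by
  ext s hs
  have hm : Measurable fun x : 𝓜 × A => K (x.1, π) s :=
    (K.measurable_coe hs).comp (by fun_prop : Measurable fun x : 𝓜 × A => (x.1, π))
  rw [predictive_apply K _ π hs, mix, lintegral_add_measure, lintegral_smul_measure,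
    lintegral_smul_measure, lintegral_pointBelief M w hm, ← predictive_apply K _ π hs]
  simp only
  rw [← Finset.sum_mul, ← ENNReal.ofReal_sum_of_nonneg fun a _ => hw.1 a, hw.2]
  simp

variable [Nonempty A] [Nonempty 𝓜] [StandardBorelSpace 𝓜] (K : Kernel (𝓜 × A) O)
  [IsMarkovKernel K]

lemma postMarginal_mem_stdSimplex (ν : Measure (𝓜 × A)) [IsFiniteMeasure ν] (π : A) (o : O) :
    postMarginal K ν π o ∈ stdSimplex ℝ A := marginal_mem_stdSimplex _

lemma measurable_postMarginal (ν : Measure (𝓜 × A)) [IsFiniteMeasure ν] (π : A) :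
    Measurable (postMarginal K ν π) :=
  measurable_pi_lambda _ fun a =>
    ((posterior (obsKernel K π) ν).measurable_coe (measurableSet_snd_eq a)).ennreal_toReal

/-- Bayes' rule: the posterior marginal is the density of the joint law with respect to the
predictive law. -/
lemma withDensity_postMarginal (ν : Measure (𝓜 × A)) [IsFiniteMeasure ν] (π a : A) :
    (predictive K ν π).withDensity (fun o => ENNReal.ofReal (postMarginal K ν π o a)) =
      jointObs K ν π a := by
  ext s hs
  have h := congrArg (fun μ => μ (s ×ˢ {x : 𝓜 × A | x.2 = a}))
    (compProd_posterior_eq_map_swap (κ := obsKernel K π) (μ := ν))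
  change ((obsKernel K π ∘ₘ ν) ⊗ₘ posterior (obsKernel K π) ν) (s ×ˢ {x : 𝓜 × A | x.2 = a}) =
    ((ν ⊗ₘ obsKernel K π).map Prod.swap) (s ×ˢ {x : 𝓜 × A | x.2 = a}) at h
  rw [Measure.compProd_apply_prod hs (measurableSet_snd_eq a),
    Measure.map_apply measurable_swap (hs.prod (measurableSet_snd_eq a)),
    Set.preimage_swap_prod, Measure.compProd_apply_prod (measurableSet_snd_eq a) hs] at h
  rw [withDensity_apply _ hs, jointObs, Measure.bind_apply hs (Kernel.aemeasurable _), ← h]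
  refine lintegral_congr fun o => ?_
  simp [postMarginal, marginal, Measure.real, ENNReal.ofReal_toReal]

/-- The posterior averages to the prior: both sides are the total mass of `jointObs`. This removes
the gradient term from the expected divergence. -/
lemma integral_postMarginal (ν : Measure (𝓜 × A)) [IsFiniteMeasure ν] (π a : A) :
    ∫ o, postMarginal K ν π o a ∂(predictive K ν π) = marginal ν a := by
  rw [integral_eq_lintegral_of_nonneg_ae (ae_of_all _ fun o =>
      (postMarginal_mem_stdSimplex K ν π o).1 a)
    ((measurable_pi_apply a).comp (measurable_postMarginal K ν π)).aestronglyMeasurable]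
  have h := congrArg (fun μ => μ Set.univ) (withDensity_postMarginal K ν π a)
  simp only [withDensity_apply _ MeasurableSet.univ, Measure.restrict_univ] at h
  rw [h, jointObs_apply K ν π a MeasurableSet.univ]
  simp [lintegral_indicator (measurableSet_snd_eq a), marginal, Measure.real]

/-- The density of `K (M, π)` with respect to the predictive law. -/
noncomputable def obsDensity (ν : Measure (𝓜 × A)) (M : 𝓜) (π : A) (o : O) : ℝ :=
  ((K (M, π)).rnDeriv (predictive K ν π) o).toReal

lemma obsDensity_nonneg (ν : Measure (𝓜 × A)) (M : 𝓜) (π : A) (o : O) :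
    0 ≤ obsDensity K ν M π o := ENNReal.toReal_nonneg

lemma measurable_obsDensity (ν : Measure (𝓜 × A)) (M : 𝓜) (π : A) :
    Measurable (obsDensity K ν M π) := (Measure.measurable_rnDeriv _ _).ennreal_toReal

variable {K} {ν : Measure (𝓜 × A)} [IsProbabilityMeasure ν] {M : 𝓜} {π : A}

lemma withDensity_obsDensity (hac : K (M, π) ≪ predictive K ν π) :
    (predictive K ν π).withDensity (fun o => ENNReal.ofReal (obsDensity K ν M π o)) =
      K (M, π) := by
  conv_rhs => rw [← Measure.withDensity_rnDeriv_eq _ _ hac]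
  refine withDensity_congr_ae ?_
  filter_upwards [Measure.rnDeriv_lt_top (K (M, π)) (predictive K ν π)] with o ho
  exact ENNReal.ofReal_toReal ho.ne

/-- The density found here is the normalizing factor in Bayes' rule for the mixture. -/
lemma predictive_mix_eq_withDensity (hac : K (M, π) ≪ predictive K ν π) {w : A → ℝ}
    (hw : w ∈ stdSimplex ℝ A) {ε : ℝ} (h0 : 0 ≤ ε) (h1 : ε ≤ 1) :
    predictive K (mix ν (pointBelief M w) ε) π = (predictive K ν π).withDensity
      fun o => ENNReal.ofReal (1 - ε + ε * obsDensity K ν M π o) := by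
  have h := toNNReal_smul_withDensity_add (predictive K ν π) (sub_nonneg.2 h1) h0
    (measurable_const (a := (1 : ℝ))) (measurable_obsDensity K ν M π) (fun _ => zero_le_one)
    (obsDensity_nonneg K ν M π)
  rw [withDensity_obsDensity hac] at h
  simp only [ENNReal.ofReal_one, mul_one] at h
  rw [predictive_mix K ν M hw, ← h]
  congr 2
  exact withDensity_one.symm

/-- The posterior marginal of a mixture with a belief concentrated on a model. -/
lemma postMarginal_mix (hac : K (M, π) ≪ predictive K ν π) {w : A → ℝ}
    (hw : w ∈ stdSimplex ℝ A) [IsFiniteMeasure (pointBelief M w)] {ε : ℝ} (h0 : 0 ≤ ε)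
    (h1 : ε ≤ 1) : ∀ᵐ o ∂(predictive K ν π),
      (1 - ε + ε * obsDensity K ν M π o) • postMarginal K (mix ν (pointBelief M w) ε) π o =
        (1 - ε) • postMarginal K ν π o + (ε * obsDensity K ν M π o) • w := by
  set m := predictive K ν π
  have hr0 := obsDensity_nonneg K ν M π
  have hrm := measurable_obsDensity K ν M π
  have hs0 : ∀ o, 0 ≤ 1 - ε + ε * obsDensity K ν M π o := fun o =>
    add_nonneg (sub_nonneg.2 h1) (mul_nonneg h0 (hr0 o))
  have key : ∀ a, ∀ᵐ o ∂m,
      (1 - ε + ε * obsDensity K ν M π o) * postMarginal K (mix ν (pointBelief M w) ε) π o a =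
        (1 - ε) * postMarginal K ν π o a + ε * (w a * obsDensity K ν M π o) := by
    intro a
    have hpm : ∀ (μ : Measure (𝓜 × A)) [IsFiniteMeasure μ],
        Measurable fun o => postMarginal K μ π o a := fun μ _ =>
      (measurable_pi_apply a).comp (measurable_postMarginal K μ π)
    have hp0 : ∀ (μ : Measure (𝓜 × A)) [IsFiniteMeasure μ] (o : O),
      0 ≤ postMarginal K μ π o a := fun μ _ o => marginal_nonneg _ a
    -- The joint law is computed twice, through Bayes' rule for the mixture and through linearity in
    -- the belief. It is finite, so the two densities agree almost everywhere.
    have e1 : jointObs K (mix ν (pointBelief M w) ε) π a = m.withDensity fun o =>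
        ENNReal.ofReal ((1 - ε + ε * obsDensity K ν M π o) *
          postMarginal K (mix ν (pointBelief M w) ε) π o a) := by
      rw [← withDensity_postMarginal K (mix ν (pointBelief M w) ε) π a,
        predictive_mix_eq_withDensity hac hw h0 h1,
        ← withDensity_mul _ (by fun_prop) (hpm _).ennreal_ofReal]
      congr 1
      ext o
      rw [Pi.mul_apply, ENNReal.ofReal_mul (hs0 o)]
    have e2 : jointObs K (mix ν (pointBelief M w) ε) π a = m.withDensity fun o =>
        ENNReal.ofReal ((1 - ε) * postMarginal K ν π o a +
          ε * (w a * obsDensity K ν M π o)) := by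
      rw [jointObs_mix, ← withDensity_postMarginal K ν π a,
        ← toNNReal_smul_withDensity_add m (sub_nonneg.2 h1) h0 (hpm ν) (hrm.const_mul (w a))
          (hp0 ν) fun o => mul_nonneg (hw.1 a) (hr0 o)]
      congr 2
      conv_lhs => rw [← withDensity_obsDensity hac]
      rw [← withDensity_smul _ (by fun_prop)]
      congr 1
      ext o
      rw [Pi.smul_apply, smul_eq_mul, ENNReal.ofReal_mul (hw.1 a)]
    have h := e1.symm.trans e2
    have hfin : ∫⁻ o, ENNReal.ofReal ((1 - ε + ε * obsDensity K ν M π o) *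
          postMarginal K (mix ν (pointBelief M w) ε) π o a) ∂m ≠ ∞ := by
      have h2 := congrArg (fun μ => μ Set.univ) e1
      simp only [withDensity_apply _ MeasurableSet.univ, Measure.restrict_univ] at h2
      rw [← h2]
      unfold jointObs
      exact measure_ne_top _ _
    have hm1 : Measurable fun o => (1 - ε + ε * obsDensity K ν M π o) *
        postMarginal K (mix ν (pointBelief M w) ε) π o a :=
      (measurable_const.add (hrm.const_mul ε)).mul (hpm _)
    have hm2 : Measurable fun o => (1 - ε) * postMarginal K ν π o a +
        ε * (w a * obsDensity K ν M π o) :=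
      ((hpm _).const_mul _).add ((hrm.const_mul _).const_mul _)
    rw [withDensity_eq_iff hm1.ennreal_ofReal.aemeasurable hm2.ennreal_ofReal.aemeasurable
      hfin] at h
    filter_upwards [h] with o ho
    refine (ENNReal.ofReal_eq_ofReal_iff (mul_nonneg (hs0 o) (hp0 _ o)) ?_).1 ho
    exact add_nonneg (mul_nonneg (sub_nonneg.2 h1) (hp0 _ o))
      (mul_nonneg h0 (mul_nonneg (hw.1 a) (hr0 o)))
  filter_upwards [ae_all_iff.2 key] with o ho
  ext a
  simp only [Pi.smul_apply, Pi.add_apply, smul_eq_mul, ho a]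
  ring

end Posterior

end BregmanAIR

namespace BregmanAIR

/-! ### The ratio as an affine functional minus the expected posterior potential. -/

section AIR

variable {A 𝓜 O : Type*} [Fintype A] [DecidableEq A] [MeasurableSpace A]
  [MeasurableSingletonClass A] [MeasurableSpace 𝓜] [MeasurableSpace O]
  [Nonempty A] [Nonempty 𝓜] [StandardBorelSpace 𝓜]

/-- The expected potential of the posterior marginal when the decision is `π`. -/
noncomputable def postPotential (Ψ : (A → ℝ) → ℝ) (K : Kernel (𝓜 × A) O) [IsMarkovKernel K]
    (ν : Measure (𝓜 × A)) [IsFiniteMeasure ν] (π : A) : ℝ :=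
  ∫ o, Ψ (postMarginal K ν π o) ∂(predictive K ν π)

variable {Ψ : (A → ℝ) → ℝ} {f : 𝓜 → A → ℝ} {K : Kernel (𝓜 × A) O} [IsMarkovKernel K]

lemma measurable_reward (hf : ∀ π, Measurable fun M => f M π) :
    Measurable fun x : 𝓜 × A => f x.1 x.2 :=
  measurable_from_prod_countable_left fun a => hf a

lemma integrable_potential_comp (hΨ : IsLegendre Ψ) (hdiam : BoundedDiam Ψ) {X : Type*}
    [MeasurableSpace X] (μ : Measure X) [IsFiniteMeasure μ] {g : X → A → ℝ} (hg : Measurable g)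
    (hgS : ∀ x, g x ∈ stdSimplex ℝ A) : Integrable (fun x => Ψ (g x)) μ := by
  obtain ⟨B, hB⟩ := exists_bound hdiam
  exact Integrable.of_bound (measurable_potential_comp hΨ hdiam hg hgS).aestronglyMeasurable B
    (ae_of_all _ fun x => hB _ (hgS x))

lemma measurable_bregman_left (hΨ : IsLegendre Ψ) (hdiam : BoundedDiam Ψ) {X : Type*}
    [MeasurableSpace X] {g : X → A → ℝ} (hg : Measurable g)
    (hgS : ∀ x, g x ∈ stdSimplex ℝ A) (v : A → ℝ) : Measurable fun x => bregman Ψ (g x) v := by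
  unfold bregman
  exact ((measurable_potential_comp hΨ hdiam hg hgS).sub_const _).sub
    (Finset.measurable_sum _ fun a _ =>
      (((measurable_pi_apply a).comp hg).sub_const _).const_mul _)

lemma exists_bregman_left_bound (hdiam : BoundedDiam Ψ) (v : A → ℝ) :
    ∃ B, ∀ u ∈ stdSimplex ℝ A, |bregman Ψ u v| ≤ B := by
  obtain ⟨B, hB⟩ := exists_bound hdiam
  refine ⟨B + |Ψ v| + ∑ a, |simplexGrad Ψ v a| * (1 + |v a|), fun u hu => ?_⟩
  unfold bregman
  refine (abs_sub _ _).trans (add_le_add ((abs_sub _ _).trans (add_le_add_left (hB u hu) _)) ?_)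
  refine (Finset.abs_sum_le_sum_abs _ _).trans (Finset.sum_le_sum fun a _ => ?_)
  rw [abs_mul]
  refine mul_le_mul_of_nonneg_left ((abs_sub _ _).trans (add_le_add_left ?_ _)) (abs_nonneg _)
  rw [abs_of_nonneg (hu.1 a), ← hu.2]
  exact Finset.single_le_sum (fun b _ => hu.1 b) (Finset.mem_univ a)

/-- The expected divergence of the posterior from the prior is the expected increase of the
potential. -/
lemma integral_bregman_postMarginal (hΨ : IsLegendre Ψ) (hdiam : BoundedDiam Ψ)
    (ν : Measure (𝓜 × A)) [IsProbabilityMeasure ν] (π : A) :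
    ∫ o, bregman Ψ (postMarginal K ν π o) (marginal ν) ∂(predictive K ν π) =
      postPotential Ψ K ν π - Ψ (marginal ν) := by
  have hi := integrable_potential_comp hΨ hdiam (predictive K ν π)
    (measurable_postMarginal K ν π) (postMarginal_mem_stdSimplex K ν π)
  have hpi : ∀ a, Integrable (fun o => postMarginal K ν π o a) (predictive K ν π) := fun a => by
    refine Integrable.of_bound ((measurable_pi_apply a).comp
      (measurable_postMarginal K ν π)).aestronglyMeasurable 1 (ae_of_all _ fun o => ?_)
    have hu := postMarginal_mem_stdSimplex K ν π o
    rw [Real.norm_eq_abs, abs_of_nonneg (hu.1 a), ← hu.2]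
    exact Finset.single_le_sum (fun b _ => hu.1 b) (Finset.mem_univ a)
  have hti : ∀ a, Integrable (fun o => simplexGrad Ψ (marginal ν) a *
      (postMarginal K ν π o a - marginal ν a)) (predictive K ν π) := fun a =>
    ((hpi a).sub (integrable_const _)).const_mul _
  have hi' : Integrable (fun o => Ψ (postMarginal K ν π o) - Ψ (marginal ν))
      (predictive K ν π) := hi.sub (integrable_const _)
  unfold bregman
  rw [integral_sub hi' (integrable_finsetSum _ fun a _ => hti a),
    integral_sub hi (integrable_const _), integral_finsetSum _ fun a _ => hti a]
  -- The gradient at the prior is a constant times a mean-zero quantity, so its value is irrelevant,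
  -- even for a prior on the boundary.
  have hz : ∀ a, ∫ o, simplexGrad Ψ (marginal ν) a * (postMarginal K ν π o a - marginal ν a)
      ∂(predictive K ν π) = 0 := fun a => by
    rw [integral_const_mul, integral_sub (hpi a) (integrable_const _), integral_postMarginal]
    simp
  simp [hz, postPotential]

/-- Expectations under the joint law of functions of `(M, π*)`, `(M, π)` and `(π, o)`. -/
lemma integral_jointLaw {r : 𝓜 × A → ℝ} (hr : Measurable r) {C : ℝ} (hC : ∀ x, ‖r x‖ ≤ C)
    {b : A → O → ℝ} (hb : ∀ π, Measurable (b π)) {B : ℝ} (hB : ∀ π o, ‖b π o‖ ≤ B)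
    (p : Measure A) [IsProbabilityMeasure p] (ν : Measure (𝓜 × A)) [IsProbabilityMeasure ν] :
    ∫ z, (r z.1.2 - r (z.1.2.1, z.1.1) - b z.1.1 z.2) ∂(jointLaw K p ν) =
      ∑ π, p.real {π} * (∫ x, (r x - r (x.1, π)) ∂ν - ∫ o, b π o ∂(predictive K ν π)) := by
  have hrm : ∀ π, Measurable fun x : 𝓜 × A => r x - r (x.1, π) := fun π =>
    hr.sub (hr.comp (by fun_prop))
  have hFm : Measurable fun z : (A × (𝓜 × A)) × O =>
      r z.1.2 - r (z.1.2.1, z.1.1) - b z.1.1 z.2 := by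
    have hbm : Measurable fun y : A × O => b y.1 y.2 := measurable_from_prod_countable_right hb
    have h1 : Measurable fun z : (A × (𝓜 × A)) × O => r z.1.2 := hr.comp (by fun_prop)
    have h2 : Measurable fun z : (A × (𝓜 × A)) × O => r (z.1.2.1, z.1.1) :=
      hr.comp (by fun_prop)
    have h3 : Measurable fun z : (A × (𝓜 × A)) × O => b z.1.1 z.2 :=
      hbm.comp (g := fun y : A × O => b y.1 y.2)
        (f := fun z : (A × (𝓜 × A)) × O => (z.1.1, z.2)) (by fun_prop)
    exact (h1.sub h2).sub h3
  have hFi : Integrable (fun z : (A × (𝓜 × A)) × O =>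
      r z.1.2 - r (z.1.2.1, z.1.1) - b z.1.1 z.2) ((p.prod ν) ⊗ₘ
        (K.comap (fun x : A × (𝓜 × A) => (x.2.1, x.1)) (by fun_prop))) :=
    Integrable.of_bound hFm.aestronglyMeasurable (C + C + B) (ae_of_all _ fun z =>
      (norm_sub_le _ _).trans (add_le_add ((norm_sub_le _ _).trans
        (add_le_add (hC _) (hC _))) (hB _ _)))
  have hbi : ∀ π (μ : Measure O), IsFiniteMeasure μ → Integrable (b π) μ := fun π μ _ =>
    Integrable.of_bound (hb π).aestronglyMeasurable B (ae_of_all _ (hB π))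
  have hinner : ∀ y : A × (𝓜 × A), ∫ o, (r y.2 - r (y.2.1, y.1) - b y.1 o)
      ∂(K.comap (fun x : A × (𝓜 × A) => (x.2.1, x.1)) (by fun_prop) y) =
      r y.2 - r (y.2.1, y.1) - ∫ o, b y.1 o ∂(obsKernel K y.1 y.2) := fun y => by
    rw [integral_sub (integrable_const _) (hbi _ _ inferInstance)]
    simp [obsKernel, Kernel.comap_apply]
  have houter : Integrable (fun y : A × (𝓜 × A) =>
      r y.2 - r (y.2.1, y.1) - ∫ o, b y.1 o ∂(obsKernel K y.1 y.2)) (p.prod ν) := by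
    have hm : Measurable fun y : A × (𝓜 × A) => ∫ o, b y.1 o ∂(obsKernel K y.1 y.2) :=
      measurable_from_prod_countable_right fun π =>
        ((hb π).stronglyMeasurable.integral_kernel (κ := obsKernel K π)).measurable
    refine Integrable.of_bound (((hr.comp measurable_snd).sub
      (hr.comp (by fun_prop))).sub hm).aestronglyMeasurable (C + C + B) (ae_of_all _ fun y => ?_)
    refine (norm_sub_le _ _).trans (add_le_add ((norm_sub_le _ _).trans
        (add_le_add (hC _) (hC _))) ?_)
    exact (norm_integral_le_of_norm_le_const (ae_of_all _ (hB y.1))).trans (by simp)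
  unfold jointLaw
  rw [Measure.integral_compProd hFi]
  simp only [hinner]
  rw [integral_prod _ houter, integral_fintype (Integrable.of_finite)]
  refine Finset.sum_congr rfl fun π _ => ?_
  rw [smul_eq_mul]
  congr 1
  have hi1 : Integrable (fun x : 𝓜 × A => r x - r (x.1, π)) ν :=
    Integrable.of_bound (hrm π).aestronglyMeasurable (C + C) (ae_of_all _ fun x =>
      (norm_sub_le _ _).trans (add_le_add (hC _) (hC _)))
  have hi2 : Integrable (fun x => ∫ o, b π o ∂(obsKernel K π x)) ν := by
    refine Integrable.of_bound (hb π).stronglyMeasurable.integral_kernel.aestronglyMeasurable B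
      (ae_of_all _ fun x => ?_)
    refine (norm_integral_le_of_norm_le_const (ae_of_all _ (hB π))).trans ?_
    simp
  have hcomp := Kernel.integral_comp (κ := Kernel.const Unit ν) (η := obsKernel K π) (a := ())
    (hbi π _ inferInstance)
  rw [← Measure.comp_eq_comp_const_apply, Kernel.const_apply] at hcomp
  rw [integral_sub hi1 hi2, predictive, hcomp]

/-- The Algorithmic Information Ratio as a linear functional of the belief minus the expected
potential of the posterior marginal. -/
lemma air_eq (hΨ : IsLegendre Ψ) (hdiam : BoundedDiam Ψ) (hf : ∀ π, Measurable fun M => f M π)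
    (hfb : ∃ C, ∀ M π, |f M π| ≤ C) (η : ℝ) (q : A → ℝ) (p : Measure A) [IsProbabilityMeasure p]
    (ν : Measure (𝓜 × A)) [IsProbabilityMeasure ν] :
    air Ψ η f K q p ν = ∑ π, p.real {π} * (∫ x, (f x.1 x.2 - f x.1 π) ∂ν - 1 / η *
      (postPotential Ψ K ν π - Ψ q - ∑ a, simplexGrad Ψ q a * (marginal ν a - q a))) := by
  obtain ⟨C, hC⟩ := hfb
  obtain ⟨B, hB⟩ := exists_bregman_left_bound hdiam (marginal ν)
  have hdm : ∀ π, Measurable fun o => bregman Ψ (postMarginal K ν π o) (marginal ν) := fun π =>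
    measurable_bregman_left hΨ hdiam (measurable_postMarginal K ν π)
      (postMarginal_mem_stdSimplex K ν π) _
  have h := integral_jointLaw (K := K) (measurable_reward hf) (C := C) (fun x => hC _ _)
    (b := fun π o => 1 / η * bregman Ψ (postMarginal K ν π o) (marginal ν) +
      1 / η * bregman Ψ (marginal ν) q)
    (fun π => ((hdm π).const_mul _).add_const _)
    (B := |1 / η| * B + |1 / η * bregman Ψ (marginal ν) q|) (fun π o => by
      refine (norm_add_le _ _).trans (add_le_add ?_ le_rfl)
      rw [norm_mul]
      exact mul_le_mul_of_nonneg_left (hB _ (postMarginal_mem_stdSimplex K ν _ _))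
        (norm_nonneg _)) p ν
  unfold air
  simp only [← sub_sub] at h
  rw [h]
  refine Finset.sum_congr rfl fun π _ => ?_
  congr 2
  rw [integral_add _ (integrable_const _), integral_const_mul,
    integral_bregman_postMarginal hΨ hdiam]
  -- The term `Ψ (marginal ν)` occurs in the two divergences with opposite signs and cancels.
  · simp only [integral_const, probReal_univ, smul_eq_mul, one_mul, bregman]
    ring
  · exact (Integrable.of_bound (hdm π).aestronglyMeasurable B
      (ae_of_all _ fun o => hB _ (postMarginal_mem_stdSimplex K ν π o))).const_mul _

end AIR

end BregmanAIR

namespace BregmanAIR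

/-! ### Fatou's lemma for the convexity gap of the expected potential. -/

section Derivative

variable {A 𝓜 O : Type*} [Fintype A] [DecidableEq A] [MeasurableSpace A]
  [MeasurableSingletonClass A] [MeasurableSpace 𝓜] [MeasurableSpace O]
  [Nonempty A] [Nonempty 𝓜] [StandardBorelSpace 𝓜]
  {Ψ : (A → ℝ) → ℝ} {f : 𝓜 → A → ℝ} {K : Kernel (𝓜 × A) O} [IsMarkovKernel K]

/-- The slack in the convexity of the expected potential of the posterior, along the mixture of
`ν` with `pointBelief M w`. -/
noncomputable def potentialSlack (Ψ : (A → ℝ) → ℝ) (K : Kernel (𝓜 × A) O) [IsMarkovKernel K]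
    (ν ν' : Measure (𝓜 × A)) [IsFiniteMeasure ν] [IsFiniteMeasure ν'] (w : A → ℝ) (π : A)
    (ε : ℝ) : ℝ :=
  Ψ w - postPotential Ψ K ν π - (postPotential Ψ K (mix ν ν' ε) π - postPotential Ψ K ν π) / ε

/-- The slack is the predictive integral of the pointwise slacks of `perspective_slack`, with `u = g
o` and `r` the density of `K (M, π)`. These are nonnegative, so Fatou's lemma applies without
integrability of the limiting divergence; the factor `r` turns the predictive law into `K (M, π)`.
-/
lemma potentialSlack_nonneg_and_le_liminf (hΨ : IsLegendre Ψ) (hdiam : BoundedDiam Ψ)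
    {ν : Measure (𝓜 × A)} [IsProbabilityMeasure ν] {M : 𝓜} {π : A}
    (hac : K (M, π) ≪ predictive K ν π) {w : A → ℝ} (hw : w ∈ stdSimplex ℝ A)
    [IsFiniteMeasure (pointBelief M w)]
    {g : O → A → ℝ} (hgm : Measurable g) (hgI : ∀ o, g o ∈ simplexInterior A)
    (hg : ∀ᵐ o ∂(predictive K ν π), g o = postMarginal K ν π o) :
    (∀ ε ∈ Set.Ioo (0 : ℝ) 1, 0 ≤ potentialSlack Ψ K ν (pointBelief M w) w π ε) ∧
      ∫⁻ o, ENNReal.ofReal (bregman Ψ w (g o)) ∂(K (M, π)) ≤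
        liminf (fun ε => ENNReal.ofReal (potentialSlack Ψ K ν (pointBelief M w) w π ε))
          (𝓝[>] 0) := by
  set m := predictive K ν π with hm
  set r : O → ℝ := obsDensity K ν M π with hr
  have hr0 : ∀ o, 0 ≤ r o := obsDensity_nonneg K ν M π
  have hrm : Measurable r := measurable_obsDensity K ν M π
  have hri : Integrable r m := Measure.integrable_toReal_rnDeriv
  have hr1 : ∫ o, r o ∂m = 1 := by
    rw [hr]; unfold obsDensity
    rw [Measure.integral_toReal_rnDeriv hac, probReal_univ]
  have hs0 : ∀ ε ∈ Set.Ioo (0 : ℝ) 1, ∀ o, 0 < 1 - ε + ε * r o := fun ε hε o => by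
    have := mul_nonneg hε.1.le (hr0 o); linarith [hε.2]
  -- the mixed posterior, for all `ε` at once
  set x : ℝ → O → A → ℝ := fun ε o =>
    (1 - ε + ε * r o)⁻¹ • ((1 - ε) • g o + (ε * r o) • w) with hx
  have hxeq : ∀ ε ∈ Set.Ioo (0 : ℝ) 1, ∀ o,
      (1 - ε + ε * r o) • x ε o = (1 - ε) • g o + (ε * r o) • w := fun ε hε o => by
    simp only [hx]; rw [smul_inv_smul₀ (hs0 ε hε o).ne']
  have hxm : ∀ ε, Measurable (x ε) := fun ε => by
    have h : Measurable fun o => 1 - ε + ε * r o := (hrm.const_mul ε).const_add _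
    exact h.inv.smul ((hgm.const_smul (1 - ε)).add ((hrm.const_mul ε).smul_const w))
  have hxS : ∀ ε ∈ Set.Ioo (0 : ℝ) 1, ∀ o, x ε o ∈ stdSimplex ℝ A := fun ε hε o => by
    have hs := hs0 ε hε o
    have h := convex_stdSimplex ℝ A (hgI o).1 hw
      (a := (1 - ε + ε * r o)⁻¹ * (1 - ε)) (b := (1 - ε + ε * r o)⁻¹ * (ε * r o))
      (mul_nonneg (inv_nonneg.2 hs.le) (sub_nonneg.2 hε.2.le))
      (mul_nonneg (inv_nonneg.2 hs.le) (mul_nonneg hε.1.le (hr0 o))) (by field_simp)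
    simpa only [hx, smul_add, smul_smul] using h
  choose Q hQ hQlim using fun o => perspective_slack hΨ (hgI o) hw (hr0 o)
    (x := fun ε => x ε o) fun ε hε => hxeq ε hε o
  -- The value `0` outside `(0, 1)` makes the integrands measurable for every `ε`, as Fatou's lemma
  -- demands.
  set k : ℝ → O → ℝ := fun ε o => if ε ∈ Set.Ioo (0 : ℝ) 1 then Q o ε else 0 with hk
  have hkQ : ∀ ε ∈ Set.Ioo (0 : ℝ) 1, k ε = fun o =>
      r o * Ψ w - Ψ (g o) - ((1 - ε + ε * r o) * Ψ (x ε o) - Ψ (g o)) / ε := fun ε hε => by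
    ext o; simp only [hk, if_pos hε]; exact (hQ o ε hε).2
  have hk0 : ∀ ε o, 0 ≤ k ε o := fun ε o => by
    simp only [hk]; split_ifs with h
    · exact (hQ o ε h).1
    · exact le_rfl
  have hgi : Integrable (fun o => Ψ (g o)) m :=
    integrable_potential_comp hΨ hdiam m hgm fun o => (hgI o).1
  have hgint : ∫ o, Ψ (g o) ∂m = postPotential Ψ K ν π := by
    refine integral_congr_ae ?_
    filter_upwards [hg] with o ho using by rw [ho]
  have hsi : ∀ ε ∈ Set.Ioo (0 : ℝ) 1,
      Integrable (fun o => (1 - ε + ε * r o) * Ψ (x ε o)) m := fun ε hε => by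
    obtain ⟨B, hB⟩ := exists_bound hdiam
    exact Integrable.mul_bdd (c := B) ((integrable_const _).add (hri.const_mul ε))
      (measurable_potential_comp hΨ hdiam (hxm ε) (hxS ε hε)).aestronglyMeasurable
      (ae_of_all _ fun o => hB _ (hxS ε hε o))
  have hsint : ∀ ε ∈ Set.Ioo (0 : ℝ) 1, ∫ o, (1 - ε + ε * r o) * Ψ (x ε o) ∂m =
      postPotential Ψ K (mix ν (pointBelief M w) ε) π := fun ε hε => by
    unfold postPotential
    rw [predictive_mix_eq_withDensity hac hw hε.1.le hε.2.le,
      integral_withDensity_eq_integral_toReal_smul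
        ((hrm.const_mul ε).const_add _).ennreal_ofReal
        (ae_of_all _ fun o => ENNReal.ofReal_lt_top)]
    -- The null set in `postMarginal_mix` depends on `ε`; this is harmless, since `ε` is fixed in
    -- each integral.
    refine integral_congr_ae ?_
    filter_upwards [hg, postMarginal_mix hac hw hε.1.le hε.2.le] with o ho ho'
    have hxo : x ε o = postMarginal K (mix ν (pointBelief M w) ε) π o := by
      have h := hxeq ε hε o
      rw [ho, ← ho'] at h
      exact smul_right_injective _ (hs0 ε hε o).ne' h
    rw [ENNReal.toReal_ofReal (hs0 ε hε o).le, hxo, smul_eq_mul]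
  have hki : ∀ ε ∈ Set.Ioo (0 : ℝ) 1, Integrable (k ε) m := fun ε hε => by
    rw [hkQ ε hε]
    exact ((hri.mul_const _).sub hgi).sub (((hsi ε hε).sub hgi).div_const _)
  have hkint : ∀ ε ∈ Set.Ioo (0 : ℝ) 1,
      ∫ o, k ε o ∂m = potentialSlack Ψ K ν (pointBelief M w) w π ε := fun ε hε => by
    have h1 : Integrable (fun o => r o * Ψ w - Ψ (g o)) m := (hri.mul_const _).sub hgi
    have h2 : Integrable (fun o => ((1 - ε + ε * r o) * Ψ (x ε o) - Ψ (g o)) / ε) m :=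
      ((hsi ε hε).sub hgi).div_const _
    rw [hkQ ε hε, integral_sub h1 h2, integral_sub (hri.mul_const _) hgi, integral_div,
      integral_sub (hsi ε hε) hgi, hsint ε hε, hgint, integral_mul_const, hr1, one_mul]
    rfl
  have hkm : ∀ ε, Measurable (k ε) := fun ε => by
    by_cases hε : ε ∈ Set.Ioo (0 : ℝ) 1
    · rw [hkQ ε hε]
      have h1 := measurable_potential_comp hΨ hdiam (hxm ε) (hxS ε hε)
      have h2 := measurable_potential_comp hΨ hdiam hgm fun o => (hgI o).1
      exact ((hrm.mul_const _).sub h2).sub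
        ((((hrm.const_mul ε).const_add _).mul h1).sub h2 |>.div_const _)
    · simp only [hk, if_neg hε]; exact measurable_const
  refine ⟨fun ε hε => by rw [← hkint ε hε]; exact integral_nonneg (hk0 ε), ?_⟩
  have hDm := measurable_bregman_comp hΨ hdiam hgm hgI hw
  calc ∫⁻ o, ENNReal.ofReal (bregman Ψ w (g o)) ∂(K (M, π))
      = ∫⁻ o, ENNReal.ofReal (r o * bregman Ψ w (g o)) ∂m := by
        conv_lhs => rw [← withDensity_obsDensity hac]
        rw [lintegral_withDensity_eq_lintegral_mul _ hrm.ennreal_ofReal hDm.ennreal_ofReal]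
        refine lintegral_congr fun o => ?_
        rw [Pi.mul_apply, ← ENNReal.ofReal_mul (hr0 o)]
    _ = ∫⁻ o, liminf (fun ε => ENNReal.ofReal (k ε o)) (𝓝[>] 0) ∂m := by
        refine lintegral_congr fun o => Eq.symm (Tendsto.liminf_eq ?_)
        refine (ENNReal.tendsto_ofReal (hQlim o)).congr' ?_
        filter_upwards [Ioo_mem_nhdsGT (zero_lt_one' ℝ)] with ε hε
        simp only [hk, if_pos hε]
    _ ≤ liminf (fun ε => ∫⁻ o, ENNReal.ofReal (k ε o) ∂m) (𝓝[>] 0) :=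
        lintegral_liminf_le fun ε => (hkm ε).ennreal_ofReal
    _ = _ := by
        refine liminf_congr ?_
        filter_upwards [Ioo_mem_nhdsGT (zero_lt_one' ℝ)] with ε hε
        rw [← hkint ε hε, ofReal_integral_eq_lintegral_ofReal (hki ε hε) (ae_of_all _ (hk0 ε))]

end Derivative

end BregmanAIR

namespace BregmanAIR

/-! ### Lower bound for the directional derivative and the optimality gap. -/

section Derivative

variable {A 𝓜 O : Type*} [Fintype A] [DecidableEq A] [MeasurableSpace A]
  [MeasurableSingletonClass A] [MeasurableSpace 𝓜] [MeasurableSpace O]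
  [Nonempty A] [Nonempty 𝓜] [StandardBorelSpace 𝓜]
  {Ψ : (A → ℝ) → ℝ} {f : 𝓜 → A → ℝ} {K : Kernel (𝓜 × A) O} [IsMarkovKernel K]

/-- By `air_eq` only the expected posterior potential fails to be affine. The first three terms are
the ratio of the point belief, whose posterior remains `w`; the convexity gap accounts for the rest,
exactly and for every `ε`. -/
lemma air_slope_eq (hΨ : IsLegendre Ψ) (hdiam : BoundedDiam Ψ)
    (hf : ∀ π, Measurable fun M => f M π) (hfb : ∃ C, ∀ M π, |f M π| ≤ C) (η : ℝ) (q : A → ℝ)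
    (p : Measure A) [IsProbabilityMeasure p] (ν : Measure (𝓜 × A)) [IsProbabilityMeasure ν]
    (M : 𝓜) {w : A → ℝ} (hw : w ∈ stdSimplex ℝ A) [IsProbabilityMeasure (pointBelief M w)]
    {ε : ℝ} (hε : ε ∈ Set.Ioo (0 : ℝ) 1) :
    (air Ψ η f K q p (mix ν (pointBelief M w) ε) - air Ψ η f K q p ν) / ε =
      ∑ a, w a * f M a - ∑ π, p.real {π} * f M π - 1 / η * bregman Ψ w q - air Ψ η f K q p ν +
        1 / η * ∑ π, p.real {π} * potentialSlack Ψ K ν (pointBelief M w) w π ε := by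
  have hP := isProbabilityMeasure_mix ν (pointBelief M w) hε.1.le hε.2.le
  have hp1 : ∑ π, p.real {π} = 1 := by
    simp [sum_measureReal_singleton (μ := p) (Finset.univ : Finset A)]
  have hlin : ∀ π, ∫ x, (f x.1 x.2 - f x.1 π) ∂(mix ν (pointBelief M w) ε) =
      (1 - ε) * ∫ x, (f x.1 x.2 - f x.1 π) ∂ν + ε * (∑ a, w a * f M a - f M π) := fun π => by
    obtain ⟨C, hC⟩ := hfb
    have hm : Measurable fun x : 𝓜 × A => f x.1 x.2 - f x.1 π :=
      (measurable_reward hf).sub ((hf π).comp measurable_fst)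
    have hi : ∀ μ : Measure (𝓜 × A), IsFiniteMeasure μ →
        Integrable (fun x => f x.1 x.2 - f x.1 π) μ := fun μ _ =>
      Integrable.of_bound hm.aestronglyMeasurable (C + C) (ae_of_all _ fun x =>
        (norm_sub_le _ _).trans (add_le_add (hC _ _) (hC _ _)))
    rw [integral_mix _ _ hε.1.le hε.2.le (hi _ inferInstance) (hi _ inferInstance),
      integral_pointBelief M hw hm]
    simp only [mul_sub, Finset.sum_sub_distrib, ← Finset.sum_mul, hw.2, one_mul]
  have hgrad : ∑ a, simplexGrad Ψ q a * (marginal (mix ν (pointBelief M w) ε) a - q a) =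
      (1 - ε) * ∑ a, simplexGrad Ψ q a * (marginal ν a - q a) +
        ε * ∑ a, simplexGrad Ψ q a * (w a - q a) := by
    rw [Finset.mul_sum, Finset.mul_sum, ← Finset.sum_add_distrib]
    refine Finset.sum_congr rfl fun a _ => ?_
    rw [marginal_mix _ _ hε.1.le hε.2.le, marginal_pointBelief M hw]
    ring
  have hsum : ∑ a, w a * f M a - ∑ π, p.real {π} * f M π - 1 / η * bregman Ψ w q =
      ∑ π, p.real {π} * (∑ a, w a * f M a - f M π - 1 / η * bregman Ψ w q) := by
    simp only [mul_sub, Finset.sum_sub_distrib, ← Finset.sum_mul, hp1, one_mul]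
  have hmul : 1 / η * ∑ π, p.real {π} * potentialSlack Ψ K ν (pointBelief M w) w π ε =
      ∑ π, 1 / η * (p.real {π} * potentialSlack Ψ K ν (pointBelief M w) w π ε) :=
    Finset.mul_sum _ _ _
  have hε0 := hε.1.ne'
  rw [div_eq_iff hε0, hsum, air_eq hΨ hdiam hf hfb, air_eq hΨ hdiam hf hfb, hgrad,
    hmul, ← Finset.sum_sub_distrib, ← Finset.sum_sub_distrib, ← Finset.sum_add_distrib,
    Finset.sum_mul]
  refine Finset.sum_congr rfl fun π _ => ?_
  rw [hlin π]
  unfold potentialSlack bregman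
  field_simp
  ring

/-- Lower bound for the derivative of the Algorithmic Information Ratio in the direction of a
belief concentrated on a model. -/
lemma le_air_add_airDeriv (hΨ : IsLegendre Ψ) (hdiam : BoundedDiam Ψ)
    (hf : ∀ π, Measurable fun M => f M π) (hfb : ∃ C, ∀ M π, |f M π| ≤ C) {η : ℝ} (hη : 0 < η)
    (q : A → ℝ) (p : Measure A) [IsProbabilityMeasure p] (ν : Measure (𝓜 × A))
    [IsProbabilityMeasure ν] (M : 𝓜) {w : A → ℝ} (hw : w ∈ stdSimplex ℝ A)
    [IsProbabilityMeasure (pointBelief M w)] {g : A → O → A → ℝ} (hgm : ∀ π, Measurable (g π))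
    (hgI : ∀ π o, g π o ∈ simplexInterior A)
    (hg : ∀ π, p {π} ≠ 0 → ∀ᵐ o ∂(predictive K ν π), g π o = postMarginal K ν π o)
    (hac : ∀ π, p {π} ≠ 0 → K (M, π) ≪ predictive K ν π) :
    ((∑ a, w a * f M a - ∑ π, p.real {π} * f M π - 1 / η * bregman Ψ w q : ℝ) : EReal) +
      ((ENNReal.ofReal (1 / η) *
        ∫⁻ π, ∫⁻ o, ENNReal.ofReal (bregman Ψ w (g π o)) ∂(K (M, π)) ∂p : ℝ≥0∞) : EReal) ≤
      (air Ψ η f K q p ν : EReal) + airDeriv Ψ η f K q p ν (pointBelief M w) := by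
  set ν' := pointBelief M w with hν'
  set c : ℝ := ∑ a, w a * f M a - ∑ π, p.real {π} * f M π - 1 / η * bregman Ψ w q
  -- With the factor `1/η` in the measure, the weighted sum of slacks becomes a lower integral,
  -- ready for Fatou's lemma over decisions.
  set μ : Measure A := ENNReal.ofReal (1 / η) • p with hμ
  set v : ℝ → ℝ≥0∞ := fun ε => ∫⁻ π, ENNReal.ofReal (potentialSlack Ψ K ν ν' w π ε) ∂μ with hv
  have hslack : ∀ π, p {π} ≠ 0 → _ := fun π hπ =>
    potentialSlack_nonneg_and_le_liminf hΨ hdiam (hac π hπ) hw (hgm π) (hgI π) (hg π hπ)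
  have hB : ENNReal.ofReal (1 / η) *
      ∫⁻ π, ∫⁻ o, ENNReal.ofReal (bregman Ψ w (g π o)) ∂(K (M, π)) ∂p ≤ liminf v (𝓝[>] 0) := by
    refine le_trans ?_ (lintegral_liminf_le fun ε => measurable_of_finite _)
    rw [hμ, lintegral_smul_measure, smul_eq_mul]
    refine mul_le_mul_right (lintegral_mono_ae ?_) _
    rw [ae_iff_of_countable]
    exact fun π hπ => (hslack π hπ).2
  have hcoe : ((liminf v (𝓝[>] 0) : ℝ≥0∞) : EReal) =
      liminf (fun ε => ((v ε : ℝ≥0∞) : EReal)) (𝓝[>] 0) :=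
    Monotone.map_liminf_of_continuousAt (f := ((↑) : ℝ≥0∞ → EReal))
      EReal.coe_ennreal_strictMono.monotone v continuous_coe_ennreal_ereal.continuousAt
  have hderiv : airDeriv Ψ η f K q p ν ν' = liminf (fun ε =>
      ((c - air Ψ η f K q p ν : ℝ) : EReal) + ((v ε : ℝ≥0∞) : EReal)) (𝓝[>] 0) := by
    unfold airDeriv
    refine liminf_congr ?_
    filter_upwards [Ioo_mem_nhdsGT (zero_lt_one' ℝ)] with ε hε
    rw [air_slope_eq hΨ hdiam hf hfb η q p ν M hw hε, EReal.coe_add]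
    congr 1
    have hnn : ∀ π, 0 ≤ p.real {π} * potentialSlack Ψ K ν ν' w π ε := fun π => by
      by_cases hπ : p {π} = 0
      · simp [Measure.real, hπ]
      · exact mul_nonneg measureReal_nonneg ((hslack π hπ).1 ε hε)
    have hvε : v ε = ENNReal.ofReal (1 / η * ∑ π, p.real {π} * potentialSlack Ψ K ν ν' w π ε) := by
      rw [hv, ENNReal.ofReal_mul (by positivity), ENNReal.ofReal_sum_of_nonneg fun π _ => hnn π]
      simp only [hμ]
      rw [lintegral_smul_measure, lintegral_fintype, smul_eq_mul]
      congr 1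
      refine Finset.sum_congr rfl fun π _ => ?_
      rw [ENNReal.ofReal_mul measureReal_nonneg, ofReal_measureReal, mul_comm]
    rw [hvε, EReal.coe_ennreal_ofReal, max_eq_left]
    exact mul_nonneg (by positivity) (Finset.sum_nonneg fun π _ => hnn π)
  have hlim : ((c - air Ψ η f K q p ν : ℝ) : EReal) + ((liminf v (𝓝[>] 0) : ℝ≥0∞) : EReal) ≤
      airDeriv Ψ η f K q p ν ν' := by
    rw [hderiv, hcoe]
    refine le_trans (add_le_add ?_ le_rfl) EReal.le_liminf_add
    rw [liminf_const]
  calc (c : EReal) + _ ≤ (c : EReal) + ((liminf v (𝓝[>] 0) : ℝ≥0∞) : EReal) :=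
        add_le_add le_rfl (EReal.coe_ennreal_le_coe_ennreal_iff.2 hB)
    _ = (air Ψ η f K q p ν : EReal) + (((c - air Ψ η f K q p ν : ℝ) : EReal) +
          ((liminf v (𝓝[>] 0) : ℝ≥0∞) : EReal)) := by
        rw [← add_assoc, ← EReal.coe_add, add_sub_cancel]
    _ ≤ _ := add_le_add le_rfl hlim

/-- The point belief competes in the supremum. The weights `w` stay free because two choices are
needed later: a vertex and the reference probability `q`. -/
lemma le_air_add_optGap (hΨ : IsLegendre Ψ) (hdiam : BoundedDiam Ψ)
    (hf : ∀ π, Measurable fun M => f M π) (hfb : ∃ C, ∀ M π, |f M π| ≤ C) {η : ℝ} (hη : 0 < η)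
    (q : A → ℝ) (p : Measure A) [IsProbabilityMeasure p] (ν : Measure (𝓜 × A))
    [IsProbabilityMeasure ν] (M : 𝓜) {w : A → ℝ} (hw : w ∈ stdSimplex ℝ A)
    {g : A → O → A → ℝ} (hgm : ∀ π, Measurable (g π))
    (hgI : ∀ π o, g π o ∈ simplexInterior A)
    (hg : ∀ π, p {π} ≠ 0 → ∀ᵐ o ∂(predictive K ν π), g π o = postMarginal K ν π o)
    (hac : ∀ π, p {π} ≠ 0 → K (M, π) ≪ predictive K ν π) :
    ((∑ a, w a * f M a - ∑ π, p.real {π} * f M π - 1 / η * bregman Ψ w q : ℝ) : EReal) +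
      ((ENNReal.ofReal (1 / η) *
        ∫⁻ π, ∫⁻ o, ENNReal.ofReal (bregman Ψ w (g π o)) ∂(K (M, π)) ∂p : ℝ≥0∞) : EReal) ≤
      (air Ψ η f K q p ν : EReal) + optGap Ψ η f K q p ν := by
  have := isProbabilityMeasure_pointBelief M hw
  refine (le_air_add_airDeriv hΨ hdiam hf hfb hη q p ν M hw hgm hgI hg hac).trans
    (add_le_add le_rfl ?_)
  exact le_iSup (fun ν' : ProbabilityMeasure (𝓜 × A) =>
    airDeriv Ψ η f K q p ν (ν' : Measure (𝓜 × A))) ⟨pointBelief M w, this⟩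

end Derivative

end BregmanAIR

namespace BregmanAIR

/-! ### Expectations in the extended reals. -/

section Expectation

variable {Ω : Type*} [MeasurableSpace Ω]

/-- Positive and negative parts of `Y` are compared with truncated differences of `W` and `c`. Only
monotonicity of the integral is applied to `Y`, so `Y` need not be measurable. -/
lemma le_expectation (P : Measure Ω) [IsProbabilityMeasure P] {Y : Ω → EReal} {W : Ω → ℝ≥0∞}
    (hW : Measurable W) {c : ℝ} (hc : 0 ≤ c) (h : ∀ ω, (W ω : EReal) - (c : EReal) ≤ Y ω) :
    ((∫⁻ ω, W ω ∂P : ℝ≥0∞) : EReal) - (c : EReal) ≤ expectation P Y := by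
  set d : ℝ≥0∞ := ENNReal.ofReal c with hd
  have hcd : (c : EReal) = (d : EReal) := by
    rw [hd, EReal.coe_ennreal_ofReal, max_eq_left hc]
  have hdt : d ≠ ⊤ := ENNReal.ofReal_ne_top
  have hdE : (d : EReal).toENNReal = d := EReal.toENNReal_coe
  have hpos : ∀ ω, W ω - d ≤ (Y ω).toENNReal := fun ω => by
    have h1 := EReal.toENNReal_le_toENNReal (h ω)
    rwa [hcd, EReal.toENNReal_sub (EReal.coe_ennreal_nonneg d), hdE, EReal.toENNReal_coe] at h1
  have hneg : ∀ ω, (-Y ω).toENNReal ≤ d - W ω := fun ω => by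
    have h1 := EReal.toENNReal_le_toENNReal (EReal.neg_le_neg_iff.2 (h ω))
    have e : -((W ω : EReal) - (c : EReal)) = (d : EReal) - (W ω : EReal) := by
      rw [EReal.neg_sub (Or.inr (EReal.coe_ne_bot c)) (Or.inr (EReal.coe_ne_top c)), add_comm,
        ← sub_eq_add_neg, hcd]
    rwa [e, EReal.toENNReal_sub (EReal.coe_ennreal_nonneg _), hdE, EReal.toENNReal_coe] at h1
  -- Pointwise, both integrands equal `max (W ω) d`.
  have hI : ∫⁻ ω, W ω ∂P + ∫⁻ ω, (d - W ω) ∂P = ∫⁻ ω, (W ω - d) ∂P + d := by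
    have hdi : ∫⁻ _, d ∂P = d := by simp
    have hr : ∫⁻ ω, (W ω - d + d) ∂P = ∫⁻ ω, (W ω - d) ∂P + d := by
      rw [lintegral_add_left (hW.sub_const d), hdi]
    rw [← lintegral_add_left hW, ← hr]
    refine lintegral_congr fun ω => ?_
    rw [add_tsub_eq_max, tsub_add_eq_max]
  have hle : ∫⁻ ω, W ω ∂P + ∫⁻ ω, (-Y ω).toENNReal ∂P ≤ ∫⁻ ω, (Y ω).toENNReal ∂P + d :=
    (add_le_add le_rfl (lintegral_mono hneg)).trans
      (hI.le.trans (add_le_add (lintegral_mono hpos) le_rfl))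
  -- This excludes `∞ - ∞` in the definition of the expectation.
  have hfin : ∫⁻ ω, (-Y ω).toENNReal ∂P ≠ ⊤ := by
    refine ne_top_of_le_ne_top hdt ?_
    calc ∫⁻ ω, (-Y ω).toENNReal ∂P ≤ ∫⁻ _, d ∂P :=
          lintegral_mono fun ω => (hneg ω).trans tsub_le_self
      _ = d := by simp
  rw [← EReal.coe_ennreal_le_coe_ennreal_iff, EReal.coe_ennreal_add, EReal.coe_ennreal_add,
    ← hcd] at hle
  unfold expectation
  rw [EReal.le_sub_iff_add_le (Or.inl (by simp)) (Or.inl (by simpa using hfin)),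
    sub_eq_add_neg, add_right_comm, ← sub_eq_add_neg]
  exact EReal.sub_le_of_le_add hle

end Expectation

/-! ### Conditioning on the history in the game. -/

section Game

variable {A 𝓜 O Ω : Type*} [MeasurableSpace A] [MeasurableSpace 𝓜] [MeasurableSpace O]
  [MeasurableSpace Ω]

lemma history_succ (act : ℕ → Ω → A) (obs : ℕ → Ω → O) (t : ℕ) (ω : Ω) :
    history act obs (t + 1) ω =
      Fin.snoc (α := fun _ => A × O) (history act obs t ω) (act t ω, obs t ω) := by
  ext i : 1
  refine Fin.lastCases ?_ (fun j => ?_) i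
  · simp [history]
  · simp [history]

lemma measurable_snoc (t : ℕ) : Measurable fun y : Hist A O t × (A × O) =>
    (Fin.snoc (α := fun _ => A × O) y.1 y.2 : Hist A O (t + 1)) := by
  refine measurable_pi_lambda _ fun i => ?_
  refine Fin.lastCases ?_ (fun j => ?_) i
  · simpa using measurable_snd
  · simp only [Fin.snoc_castSucc]
    exact (measurable_pi_apply j).comp measurable_fst

lemma measurable_snoc_right {t : ℕ} (h : Hist A O t) : Measurable fun y : A × O =>
    (Fin.snoc (α := fun _ => A × O) h y : Hist A O (t + 1)) :=
  (measurable_snoc t).comp (measurable_prodMk_left (x := h))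

instance (K : Kernel (𝓜 × A) O) [IsMarkovKernel K] {t : ℕ} (p : Kernel (Hist A O t) A)
    [IsMarkovKernel p] (env : Hist A O t → 𝓜) (henv : Measurable env) :
    IsMarkovKernel (roundKernel K p env henv) := by
  unfold roundKernel; infer_instance

lemma lintegral_roundKernel (K : Kernel (𝓜 × A) O) [IsMarkovKernel K] {t : ℕ}
    (p : Kernel (Hist A O t) A) [IsMarkovKernel p] (env : Hist A O t → 𝓜) (henv : Measurable env)
    (h : Hist A O t) {F : A × O → ℝ≥0∞} (hF : Measurable F) :
    ∫⁻ y, F y ∂(roundKernel K p env henv h) = ∫⁻ π, ∫⁻ o, F (π, o) ∂(K (env h, π)) ∂(p h) := by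
  unfold roundKernel
  rw [Kernel.lintegral_compProd _ _ _ hF]
  rfl

namespace IsGame

variable {P : Measure Ω} [IsProbabilityMeasure P] {T : ℕ} {K : Kernel (𝓜 × A) O}
  [IsMarkovKernel K] {p : ∀ t, Kernel (Hist A O t) A} [∀ t, IsMarkovKernel (p t)]
  {env : ∀ t, Hist A O t → 𝓜} {henv : ∀ t, Measurable (env t)} {act : ℕ → Ω → A}
  {obs : ℕ → Ω → O} (hgame : IsGame P T K p env henv act obs)
include hgame

lemma measurable_history (t : ℕ) : Measurable (history act obs t) :=
  measurable_pi_lambda _ fun i => (hgame.measurable_act i).prodMk (hgame.measurable_obs i)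

/-- The tower property; it turns the expected next divergence into a conditional expectation given
the current history. -/
lemma lintegral_history_succ {t : ℕ} (ht : t < T) {V : Hist A O (t + 1) → ℝ≥0∞}
    (hV : Measurable V) :
    ∫⁻ ω, V (history act obs (t + 1) ω) ∂P =
      ∫⁻ ω, ∫⁻ y, V (Fin.snoc (α := fun _ => A × O) (history act obs t ω) y)
        ∂(roundKernel K (p t) (env t) (henv t) (history act obs t ω)) ∂P := by
  have hm := hgame.measurable_history t
  have hVs : Measurable fun y : Hist A O t × (A × O) =>
      V (Fin.snoc (α := fun _ => A × O) y.1 y.2) := hV.comp (measurable_snoc t)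
  have h := Measure.lintegral_compProd (μ := P.map (history act obs t))
    (κ := roundKernel K (p t) (env t) (henv t)) hVs
  rw [← hgame.law t ht, lintegral_map hVs (hm.prodMk
    ((hgame.measurable_act t).prodMk (hgame.measurable_obs t))),
    lintegral_map hVs.lintegral_kernel_prod_right' hm] at h
  simp only [history_succ]
  exact h

lemma integral_act [Fintype A] [MeasurableSingletonClass A] {t : ℕ} (ht : t < T)
    {f : 𝓜 → A → ℝ} (hf : ∀ π, Measurable fun M => f M π) {C : ℝ} (hC : ∀ M π, |f M π| ≤ C) :
    ∫ ω, f (env t (history act obs t ω)) (act t ω) ∂P =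
      ∫ ω, ∑ π, (p t (history act obs t ω)).real {π} * f (env t (history act obs t ω)) π ∂P := by
  have hm := hgame.measurable_history t
  have hfm : Measurable fun x : 𝓜 × A => f x.1 x.2 := measurable_from_prod_countable_left hf
  have hF : Measurable fun y : Hist A O t × (A × O) => f (env t y.1) y.2.1 :=
    hfm.comp (g := fun x : 𝓜 × A => f x.1 x.2)
      (f := fun y : Hist A O t × (A × O) => (env t y.1, y.2.1))
      (((henv t).comp measurable_fst).prodMk (measurable_fst.comp measurable_snd))
  have h := Measure.integral_compProd (μ := P.map (history act obs t))
    (κ := roundKernel K (p t) (env t) (henv t)) (f := fun y => f (env t y.1) y.2.1)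
    (Integrable.of_bound hF.aestronglyMeasurable C (ae_of_all _ fun y => hC _ _))
  have hinner : ∀ x : Hist A O t, ∫ y, f (env t x) y.1 ∂(roundKernel K (p t) (env t) (henv t) x) =
      ∑ π, (p t x).real {π} * f (env t x) π := fun x => by
    unfold roundKernel
    have hfx : Measurable fun y : A × O => f (env t x) y.1 :=
      (measurable_of_finite (f (env t x))).comp measurable_fst
    rw [ProbabilityTheory.integral_compProd
      (Integrable.of_bound hfx.aestronglyMeasurable C (ae_of_all _ fun y => hC _ _))]
    simp only [integral_const, probReal_univ, smul_eq_mul, one_mul]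
    rw [integral_fintype Integrable.of_finite]
    simp
  simp only [hinner] at h
  have hsm : Measurable fun x : Hist A O t => ∑ π, (p t x).real {π} * f (env t x) π :=
    Finset.measurable_sum _ fun π _ =>
      (((p t).measurable_coe (measurableSet_singleton π)).ennreal_toReal).mul
        ((hf π).comp (henv t))
  rw [← hgame.law t ht, integral_map (hm.prodMk ((hgame.measurable_act t).prodMk
    (hgame.measurable_obs t))).aemeasurable hF.aestronglyMeasurable,
    integral_map hm.aemeasurable hsm.aestronglyMeasurable] at h
  exact h

/-- The expected regret against a fixed decision, as a sum of conditional expectations. -/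
lemma integral_regret [Fintype A] [MeasurableSingletonClass A]
    {f : 𝓜 → A → ℝ} (hf : ∀ π, Measurable fun M => f M π) {C : ℝ} (hC : ∀ M π, |f M π| ≤ C)
    (e : A) :
    ∫ ω, (∑ t ∈ Finset.range T, f (env t (history act obs t ω)) e
      - ∑ t ∈ Finset.range T, f (env t (history act obs t ω)) (act t ω)) ∂P =
      ∑ t ∈ Finset.range T, ∫ ω, (f (env t (history act obs t ω)) e -
        ∑ π, (p t (history act obs t ω)).real {π} * f (env t (history act obs t ω)) π) ∂P := by
  have hm := hgame.measurable_history
  have hfm : Measurable fun x : 𝓜 × A => f x.1 x.2 := measurable_from_prod_countable_left hf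
  have hi : ∀ t π, Integrable (fun ω => f (env t (history act obs t ω)) π) P := fun t π =>
    Integrable.of_bound ((hf π).comp ((henv t).comp (hm t))).aestronglyMeasurable C
      (ae_of_all _ fun ω => hC _ _)
  have hi2 : ∀ t, Integrable (fun ω => f (env t (history act obs t ω)) (act t ω)) P := fun t =>
    Integrable.of_bound (hfm.comp (((henv t).comp (hm t)).prodMk
      (hgame.measurable_act t))).aestronglyMeasurable C (ae_of_all _ fun ω => hC _ _)
  have hi3 : ∀ t, Integrable (fun ω => ∑ π, (p t (history act obs t ω)).real {π} *
      f (env t (history act obs t ω)) π) P := fun t =>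
    integrable_finsetSum _ fun π _ => (hi t π).bdd_mul (c := 1)
      ((((p t).measurable_coe (measurableSet_singleton π)).ennreal_toReal).comp
        (hm t)).aestronglyMeasurable
      (ae_of_all _ fun ω => by
        rw [Real.norm_eq_abs, abs_of_nonneg measureReal_nonneg]; exact measureReal_le_one)
  rw [integral_sub (integrable_finsetSum _ fun t _ => hi t e)
    (integrable_finsetSum _ fun t _ => hi2 t), integral_finsetSum _ fun t _ => hi t e,
    integral_finsetSum _ fun t _ => hi2 t, ← Finset.sum_sub_distrib]
  refine Finset.sum_congr rfl fun t ht => ?_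
  rw [hgame.integral_act (henv := henv) (Finset.mem_range.1 ht) hf hC,
    ← integral_sub (hi t e) (hi3 t)]

end IsGame

end Game

end BregmanAIR

namespace BregmanAIR

/-! ### The inequality for one round. -/

section Round

variable {A 𝓜 O : Type*} [Fintype A] [DecidableEq A] [MeasurableSpace A]
  [MeasurableSingletonClass A] [MeasurableSpace 𝓜] [MeasurableSpace O]
  [Nonempty A] [Nonempty 𝓜] [StandardBorelSpace 𝓜]
  {Ψ : (A → ℝ) → ℝ} {f : 𝓜 → A → ℝ} {K : Kernel (𝓜 × A) O} [IsMarkovKernel K]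

/-- The bound for one round, with competitor `e`, as a truncated difference. -/
lemma round_bound (hΨ : IsLegendre Ψ) (hdiam : BoundedDiam Ψ)
    (hf : ∀ π, Measurable fun M => f M π) {C : ℝ} (hC : ∀ M π, |f M π| ≤ C) {η : ℝ} (hη : 0 < η)
    {q : A → ℝ} (hq : q ∈ simplexInterior A) (p : Measure A) [IsProbabilityMeasure p]
    (ν : Measure (𝓜 × A)) [IsProbabilityMeasure ν] (M : 𝓜) (e : A)
    {g : A → O → A → ℝ} (hgm : ∀ π, Measurable (g π)) (hgI : ∀ π o, g π o ∈ simplexInterior A)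
    (hg : ∀ π, p {π} ≠ 0 → ∀ᵐ o ∂(predictive K ν π), g π o = postMarginal K ν π o)
    (hac : ∀ π, p {π} ≠ 0 → K (M, π) ≪ predictive K ν π) :
    ((ENNReal.ofReal (f M e - ∑ π, p.real {π} * f M π + 2 * C) +
        ∫⁻ π, ∫⁻ o, ENNReal.ofReal (1 / η) *
          ENNReal.ofReal (bregman Ψ (Pi.single e 1) (g π o)) ∂(K (M, π)) ∂p -
        ENNReal.ofReal (1 / η) * ENNReal.ofReal (bregman Ψ (Pi.single e 1) q) : ℝ≥0∞) : EReal) -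
      ((2 * C : ℝ) : EReal) ≤ (air Ψ η f K q p ν : EReal) + optGap Ψ η f K q p ν := by
  have heS : (Pi.single e 1 : A → ℝ) ∈ stdSimplex ℝ A := single_mem_stdSimplex ℝ e
  have hp1 : ∑ π, p.real {π} = 1 := by simp [sum_measureReal_singleton (μ := p)]
  have hpf : ∑ π, p.real {π} * f M π ≤ C := by
    calc ∑ π, p.real {π} * f M π ≤ ∑ π, p.real {π} * C := Finset.sum_le_sum fun π _ =>
          mul_le_mul_of_nonneg_left (abs_le.1 (hC M π)).2 measureReal_nonneg
      _ = C := by rw [← Finset.sum_mul, hp1, one_mul]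
  have hwf : ∀ w ∈ stdSimplex ℝ A, -C ≤ ∑ a, w a * f M a := fun w hw => by
    calc -C = ∑ a, w a * (-C) := by rw [← Finset.sum_mul, hw.2, one_mul]
      _ ≤ _ := Finset.sum_le_sum fun a _ =>
          mul_le_mul_of_nonneg_left (abs_le.1 (hC M a)).1 (hw.1 a)
  have main := le_air_add_optGap hΨ hdiam hf ⟨C, hC⟩ hη q p ν M heS hgm hgI hg hac
  -- For `w = q` the divergence from `q` vanishes, which gives the floor `-2C`. The bound in `main`
  -- has no such floor, as the divergence of the vertex from `q` is not uniformly bounded.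
  have low := le_air_add_optGap hΨ hdiam hf ⟨C, hC⟩ hη q p ν M hq.1 hgm hgI hg hac
  have hD := bregman_nonneg hΨ hq heS
  simp only [lintegral_const_mul' _ _ ENNReal.ofReal_ne_top]
  set B : ℝ≥0∞ := ENNReal.ofReal (1 / η) *
    ∫⁻ π, ∫⁻ o, ENNReal.ofReal (bregman Ψ (Pi.single e 1) (g π o)) ∂(K (M, π)) ∂p
  set Y : EReal := (air Ψ η f K q p ν : EReal) + optGap Ψ η f K q p ν
  have hes : ∑ a, (Pi.single e 1 : A → ℝ) a * f M a = f M e := by simp [Pi.single_apply]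
  rw [hes] at main
  have ha0 : 0 ≤ f M e - ∑ π, p.real {π} * f M π + 2 * C := by
    have := (abs_le.1 (hC M e)).1; linarith
  set a : ℝ := f M e - ∑ π, p.real {π} * f M π + 2 * C with ha
  set v : ℝ := 1 / η * bregman Ψ (Pi.single e 1) q with hv
  have hv0 : 0 ≤ v := mul_nonneg (by positivity) hD
  rw [← ENNReal.ofReal_mul (by positivity), ← hv]
  refine EReal.sub_le_of_le_add ?_
  -- If the truncated difference is zero, `low` suffices; otherwise it is a genuine difference and
  -- `main` applies.
  rcases le_total (ENNReal.ofReal a + B) (ENNReal.ofReal v) with hle | hle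
  · rw [tsub_eq_zero_of_le hle]
    have h1 : ((-(2 * C) : ℝ) : EReal) ≤ Y := by
      refine le_trans ?_ ((le_add_of_nonneg_right (EReal.coe_ennreal_nonneg _)).trans low)
      rw [EReal.coe_le_coe_iff, bregman_self]
      have := hwf q hq.1
      linarith
    have h2 := add_le_add h1 (le_refl ((2 * C : ℝ) : EReal))
    rw [← EReal.coe_add] at h2
    simpa using h2
  · rw [ENNReal.toEReal_sub ENNReal.ofReal_ne_top hle, EReal.coe_ennreal_add,
      EReal.coe_ennreal_ofReal, EReal.coe_ennreal_ofReal, max_eq_left ha0, max_eq_left hv0]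
    have h2 := add_le_add main (le_refl ((2 * C : ℝ) : EReal))
    refine le_trans (le_of_eq ?_) h2
    have e1 : a = f M e - ∑ π, p.real {π} * f M π - v + 2 * C + v := by rw [ha]; ring
    rw [e1, EReal.coe_add _ v, EReal.coe_add _ (2 * C), add_right_comm, EReal.add_sub_cancel_right,
      add_right_comm]

end Round

/-! ### Telescoping without subtraction. -/

section Telescope

/-- The potentials `v t` may be infinite, so they are kept on both sides as summands and never
cancelled. -/
lemma telescope {a w v : ℕ → ℝ≥0∞} {T : ℕ} (h : ∀ t < T, a t + v (t + 1) ≤ w t + v t) :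
    ∑ t ∈ Finset.range T, a t + v T ≤ ∑ t ∈ Finset.range T, w t + v 0 := by
  induction T with
  | zero => simp
  | succ n ih =>
    rw [Finset.sum_range_succ, Finset.sum_range_succ]
    calc ∑ t ∈ Finset.range n, a t + a n + v (n + 1)
        = ∑ t ∈ Finset.range n, a t + (a n + v (n + 1)) := by rw [add_assoc]
      _ ≤ ∑ t ∈ Finset.range n, a t + (w n + v n) := add_le_add le_rfl (h n (Nat.lt_succ_self n))
      _ = (∑ t ∈ Finset.range n, a t + v n) + w n := by ring
      _ ≤ (∑ t ∈ Finset.range n, w t + v 0) + w n :=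
          add_le_add (ih fun t ht => h t (ht.trans (Nat.lt_succ_self n))) le_rfl
      _ = _ := by ring

lemma sum_coe_sub_le {T : ℕ} {W : ℕ → ℝ≥0∞} {Y : ℕ → EReal} {c : ℝ}
    (h : ∀ t < T, (W t : EReal) - (c : EReal) ≤ Y t) :
    ((∑ t ∈ Finset.range T, W t : ℝ≥0∞) : EReal) - ((T * c : ℝ) : EReal) ≤
      ∑ t ∈ Finset.range T, Y t := by
  induction T with
  | zero => simp
  | succ n ih =>
    rw [Finset.sum_range_succ, Finset.sum_range_succ]
    refine le_trans (le_of_eq ?_) (add_le_add (ih fun t ht => h t (ht.trans (Nat.lt_succ_self n)))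
      (h n (Nat.lt_succ_self n)))
    have e : ((n + 1 : ℕ) : ℝ) * c = n * c + c := by push_cast; ring
    rw [e, EReal.coe_ennreal_add, EReal.coe_add,
      EReal.add_sub_add_comm (Or.inl (EReal.coe_ne_bot _)) (Or.inl (EReal.coe_ne_top _))]

end Telescope

end BregmanAIR

theorem theoremA1
    {A 𝓜 O Ω : Type*}
    [Fintype A] [DecidableEq A] [Nonempty A] [MeasurableSpace A] [MeasurableSingletonClass A]
    [MetricSpace 𝓜] [Nonempty 𝓜] [CompactSpace 𝓜] [MeasurableSpace 𝓜] [BorelSpace 𝓜]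
    [MeasurableSpace O]
    -- the laws `K (M, π) = M(π)` and the mean rewards `f M π`
    (K : Kernel (𝓜 × A) O) [IsMarkovKernel K]
    (f : 𝓜 → A → ℝ) (hf : ∀ π, Measurable fun M => f M π) (hfb : ∃ C, ∀ M π, |f M π| ≤ C)
    -- the potential and the learning rate
    (Ψ : (A → ℝ) → ℝ) (hΨ : BregmanAIR.IsLegendre Ψ) (hdiam : BregmanAIR.BoundedDiam Ψ)
    (η : ℝ) (hη : 0 < η) (T : ℕ)
    -- the algorithm, the environment, and the game they play
    (p : ∀ t, Kernel (BregmanAIR.Hist A O t) A) [∀ t, IsMarkovKernel (p t)]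
    (env : ∀ t, BregmanAIR.Hist A O t → 𝓜) (henv : ∀ t, Measurable (env t))
    [MeasurableSpace Ω] (P : Measure Ω) [IsProbabilityMeasure P]
    (act : ℕ → Ω → A) (obs : ℕ → Ω → O)
    (hgame : BregmanAIR.IsGame P T K p env henv act obs)
    -- the beliefs and the reference probabilities, as functions of the history
    (ν : ∀ t, Kernel (BregmanAIR.Hist A O t) (𝓜 × A)) [∀ t, IsMarkovKernel (ν t)]
    (q : ∀ t, BregmanAIR.Hist A O t → A → ℝ) (hqm : ∀ t, Measurable (q t))
    (hqint : ∀ t h, q t h ∈ BregmanAIR.simplexInterior A)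
    -- the first reference probability minimizes the potential
    (hq0 : ∀ h, IsMinOn Ψ (stdSimplex ℝ A) (q 0 h))
    -- the next one is the marginal posterior given the decision and the observation
    (hqpost : ∀ t < T, ∀ (h : BregmanAIR.Hist A O t) (π : A), p t h {π} ≠ 0 →
      ∀ᵐ o ∂(BregmanAIR.predictive K (ν t h) π),
        q (t + 1) (Fin.snoc (α := fun _ => A × O) h (π, o)) =
          BregmanAIR.postMarginal K (ν t h) π o)
    -- the posterior is determined at the actual observation
    (hac : ∀ t < T, ∀ (h : BregmanAIR.Hist A O t) (π : A), p t h {π} ≠ 0 →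
      K (env t h, π) ≪ BregmanAIR.predictive K (ν t h) π) :
    ((BregmanAIR.regret P T f env act obs : ℝ) : EReal) ≤
      ((BregmanAIR.diam Ψ / η : ℝ) : EReal) +
        BregmanAIR.expectation P (fun ω => ∑ t ∈ Finset.range T,
          (((BregmanAIR.air Ψ η f K (q t (BregmanAIR.history act obs t ω))
              (p t (BregmanAIR.history act obs t ω))
              (ν t (BregmanAIR.history act obs t ω)) : ℝ) : EReal) +
            BregmanAIR.optGap Ψ η f K (q t (BregmanAIR.history act obs t ω))
              (p t (BregmanAIR.history act obs t ω))
              (ν t (BregmanAIR.history act obs t ω)))) := by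
  classical
  obtain ⟨C, hC⟩ := hfb
  have hC0 : 0 ≤ C := (abs_nonneg _).trans (hC (Classical.arbitrary 𝓜) (Classical.arbitrary A))
  -- There are finitely many decisions, so one competitor attains the regret.
  obtain ⟨e, he⟩ := exists_eq_ciSup_of_finite (f := fun π : A =>
    ∫ ω, (∑ t ∈ Finset.range T, f (env t (BregmanAIR.history act obs t ω)) π
    - ∑ t ∈ Finset.range T, f (env t (BregmanAIR.history act obs t ω)) (act t ω)) ∂P)
  unfold BregmanAIR.regret
  rw [← he]
  have hm : ∀ t, Measurable (BregmanAIR.history act obs t) := hgame.measurable_history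
  have heS : (Pi.single e 1 : A → ℝ) ∈ stdSimplex ℝ A := single_mem_stdSimplex ℝ e
  -- the terms of the telescoping sum, as functions of the history
  set r : ∀ t, BregmanAIR.Hist A O t → ℝ := fun t h =>
    f (env t h) e - ∑ π, (p t h).real {π} * f (env t h) π with hr
  set V : ∀ t, BregmanAIR.Hist A O t → ℝ≥0∞ := fun t h =>
    ENNReal.ofReal (1 / η) * ENNReal.ofReal (BregmanAIR.bregman Ψ (Pi.single e 1) (q t h)) with hV
  -- The conditional expectation of the next `V` given the history.
  set B : ∀ t, BregmanAIR.Hist A O t → ℝ≥0∞ := fun t h =>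
    ∫⁻ y, V (t + 1) (Fin.snoc (α := fun _ => A × O) h y)
      ∂(BregmanAIR.roundKernel K (p t) (env t) (henv t) h) with hB
  set W : ∀ t, BregmanAIR.Hist A O t → ℝ≥0∞ := fun t h =>
    ENNReal.ofReal (r t h + 2 * C) + B t h - V t h with hW
  have hVm : ∀ t, Measurable (V t) := fun t =>
    (BregmanAIR.measurable_bregman_comp hΨ hdiam (hqm t) (hqint t)
      heS).ennreal_ofReal.const_mul _
  have hVsm : ∀ t, Measurable fun y : BregmanAIR.Hist A O t × (A × O) =>
      V (t + 1) (Fin.snoc (α := fun _ => A × O) y.1 y.2) := fun t =>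
    (hVm (t + 1)).comp (BregmanAIR.measurable_snoc t)
  have hBm : ∀ t, Measurable (B t) := fun t => (hVsm t).lintegral_kernel_prod_right'
  have hrm : ∀ t, Measurable (r t) := fun t =>
    ((hf e).comp (henv t)).sub (Finset.measurable_sum _ fun π _ =>
      (((p t).measurable_coe (measurableSet_singleton π)).ennreal_toReal).mul
        ((hf π).comp (henv t)))
  have ham : ∀ t, Measurable fun h => ENNReal.ofReal (r t h + 2 * C) := fun t =>
    ((hrm t).add_const _).ennreal_ofReal
  have hWm : ∀ t, Measurable (W t) := fun t => ((ham t).add (hBm t)).sub (hVm t)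
  have hWω : ∀ t, Measurable fun ω => W t (BregmanAIR.history act obs t ω) := fun t =>
    (hWm t).comp (hm t)
  have haω : ∀ t, Measurable fun ω =>
      ENNReal.ofReal (r t (BregmanAIR.history act obs t ω) + 2 * C) := fun t =>
    (ham t).comp (hm t)
  have hround : ∀ t < T, ∀ h, (W t h : EReal) - ((2 * C : ℝ) : EReal) ≤
      (BregmanAIR.air Ψ η f K (q t h) (p t h) (ν t h) : EReal) +
        BregmanAIR.optGap Ψ η f K (q t h) (p t h) (ν t h) := fun t ht h => by
    have hVh : Measurable fun y : A × O => V (t + 1) (Fin.snoc (α := fun _ => A × O) h y) :=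
      (hVm (t + 1)).comp (BregmanAIR.measurable_snoc_right h)
    have hBe := BregmanAIR.lintegral_roundKernel K (p t) (env t) (henv t) h hVh
    simp only [hW, hB, hBe]
    simp only [hV, hr]
    refine BregmanAIR.round_bound hΨ hdiam hf hC hη (hqint t h) (p t h) (ν t h) (env t h) e
      (g := fun π o => q (t + 1) (Fin.snoc (α := fun _ => A × O) h (π, o))) (fun π => ?_)
      (fun π o => hqint _ _) (hqpost t ht h) (hac t ht h)
    exact (hqm (t + 1)).comp ((BregmanAIR.measurable_snoc_right h).comp
      (measurable_prodMk_left (x := π)))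
  have hexp := BregmanAIR.le_expectation P
    (W := fun ω => ∑ t ∈ Finset.range T, W t (BregmanAIR.history act obs t ω))
    (Finset.measurable_sum _ fun t _ => hWω t) (c := T * (2 * C)) (by positivity)
    fun ω => BregmanAIR.sum_coe_sub_le (T := T)
      (W := fun t => W t (BregmanAIR.history act obs t ω))
      fun t ht => hround t ht (BregmanAIR.history act obs t ω)
  rw [lintegral_finsetSum _ fun t _ => hWω t] at hexp
  have htel := BregmanAIR.telescope (T := T)
    (a := fun t => ∫⁻ ω, ENNReal.ofReal (r t (BregmanAIR.history act obs t ω) + 2 * C) ∂P)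
    (w := fun t => ∫⁻ ω, W t (BregmanAIR.history act obs t ω) ∂P)
    (v := fun t => ∫⁻ ω, V t (BregmanAIR.history act obs t ω) ∂P) fun t ht => by
      rw [hgame.lintegral_history_succ (henv := henv) ht (hVm (t + 1)),
        ← lintegral_add_left (haω t), ← lintegral_add_left (hWω t)]
      -- Truncation only increases the difference, so `W + V` dominates the shifted regret plus `B`,
      -- which is the direction needed.
      exact lintegral_mono fun ω => le_tsub_add
  have hV0 : ∫⁻ ω, V 0 (BregmanAIR.history act obs 0 ω) ∂P ≤
      ENNReal.ofReal (BregmanAIR.diam Ψ / η) := by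
    calc _ ≤ ∫⁻ _, ENNReal.ofReal (BregmanAIR.diam Ψ / η) ∂P := lintegral_mono fun ω => by
          simp only [hV]
          rw [← ENNReal.ofReal_mul (by positivity), div_eq_mul_one_div (BregmanAIR.diam Ψ),
            mul_comm (1 / η)]
          exact ENNReal.ofReal_le_ofReal (mul_le_mul_of_nonneg_right
            (BregmanAIR.bregman_le_diam hΨ hdiam (hqint 0 _) heS (hq0 _)) (by positivity))
      _ = _ := by simp
  have hdiam0 : 0 ≤ BregmanAIR.diam Ψ :=
    le_csSup hdiam ⟨Pi.single e 1, heS, Pi.single e 1, heS, (sub_self _).symm⟩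
  have hrb : ∀ t h, |r t h| ≤ 2 * C := fun t h => by
    have hp1 : ∑ π, (p t h).real {π} = 1 := by simp [sum_measureReal_singleton (μ := p t h)]
    have h1 : |∑ π, (p t h).real {π} * f (env t h) π| ≤ C := by
      calc _ ≤ ∑ π, |(p t h).real {π} * f (env t h) π| := Finset.abs_sum_le_sum_abs _ _
        _ ≤ ∑ π, (p t h).real {π} * C := Finset.sum_le_sum fun π _ => by
            rw [abs_mul, abs_of_nonneg measureReal_nonneg]
            exact mul_le_mul_of_nonneg_left (hC _ _) measureReal_nonneg
        _ = C := by rw [← Finset.sum_mul, hp1, one_mul]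
    have h2 := hC (env t h) e
    rw [abs_le] at h1 h2 ⊢
    simp only [hr]
    constructor <;> linarith [h1.1, h1.2, h2.1, h2.2]
  have hri : ∀ t, Integrable (fun ω => r t (BregmanAIR.history act obs t ω)) P := fun t =>
    Integrable.of_bound ((hrm t).comp (hm t)).aestronglyMeasurable (2 * C)
      (ae_of_all _ fun ω => hrb t _)
  have haint : ∀ t, ∫⁻ ω, ENNReal.ofReal (r t (BregmanAIR.history act obs t ω) + 2 * C) ∂P =
      ENNReal.ofReal (∫ ω, r t (BregmanAIR.history act obs t ω) ∂P + 2 * C) := fun t => by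
    have hri' : Integrable (fun ω => r t (BregmanAIR.history act obs t ω) + 2 * C) P :=
      (hri t).add (integrable_const _)
    rw [← ofReal_integral_eq_lintegral_ofReal hri'
      (ae_of_all _ fun ω => ?_), integral_add (hri t) (integrable_const _)]
    · simp
    · have := (abs_le.1 (hrb t (BregmanAIR.history act obs t ω))).1
      show 0 ≤ r t (BregmanAIR.history act obs t ω) + 2 * C
      linarith
  have hnn : ∀ t, 0 ≤ ∫ ω, r t (BregmanAIR.history act obs t ω) ∂P + 2 * C := fun t => by
    have h1 := integral_mono (integrable_const (-(2 * C))) (hri t)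
      fun ω => (abs_le.1 (hrb t (BregmanAIR.history act obs t ω))).1
    simp only [integral_const, probReal_univ, smul_eq_mul, one_mul] at h1
    linarith
  rw [hgame.integral_regret (henv := henv) hf hC e]
  simp only [haint] at htel
  rw [← ENNReal.ofReal_sum_of_nonneg fun t _ => hnn t, Finset.sum_add_distrib] at htel
  simp only [Finset.sum_const, Finset.card_range, nsmul_eq_mul] at htel
  -- The last divergence is dropped. The shifts have added up to `T * (2 * C)`, the very constant
  -- subtracted in `hexp`.
  have hfinal := (le_self_add.trans htel).trans (add_le_add le_rfl hV0)
  rw [← EReal.coe_ennreal_le_coe_ennreal_iff, EReal.coe_ennreal_add, EReal.coe_ennreal_ofReal,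
    EReal.coe_ennreal_ofReal, max_eq_left (div_nonneg hdiam0 hη.le)] at hfinal
  have hfinal' := ((EReal.coe_le_coe_iff.2 (le_max_left _ (0 : ℝ))).trans hfinal)
  rw [EReal.coe_add] at hfinal'
  refine le_trans ?_ (add_le_add le_rfl hexp)
  rw [add_comm, sub_eq_add_neg, add_right_comm, ← sub_eq_add_neg,
    EReal.le_sub_iff_add_le (Or.inl (EReal.coe_ne_bot _)) (Or.inl (EReal.coe_ne_top _))]
  exact hfinal'
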